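/- Let $G=(V,E)$ be an infinite connected graph with bounded vertex degrees. For a finite set $F\subset V$ put $\partial F=\{p\in F : \text{some } q\notin F \text{ is adjacent to } p\}$; a Følner sequence is a sequence of nonempty finite sets $Q_n\subset V$ with $|\partial Q_n|/|Q_n|\to 0$. Assume that $G$ has a Følner sequence. Two vertices $x,y$ have the same $r$-pattern if there is a graph isomorphism $B_r(x)\to B_r(y)$ of the balls of radius $r$ which maps $x$ to $y$. Assume that $G$ is an abstract quasicrystal graph: for every $r$ and every $r$-pattern $\alpha$ there is a number $P(\alpha)$ such that $|\{x\in Q_n : x \text{ has } r\text{-pattern } \alpha\}|/|Q_n|\to P(\alpha)$ for every Følner sequence $(Q_n)$. Let $P_G$ be the $*$-algebra of pattern-invariant matrices, that is, of the functions $A:V\times V\to\mathbb C$ for which there is an $r_A$ such that $A(x,y)=0$ whenever $d_G(x,y)>r_A$, and $A(x,y)=A(\phi(x),\phi(y))$ for all $y\in B_{r_A}(x)$ and all graph isomorphisms $\phi:B_{r_A}(x)\to B_{r_A}(x')$ with $\phi(x)=x'$; the product is $(AB)(x,y)=\sum_z A(x,z)B(z,y)$ and $A^*(x,y)=\overline{A(y,x)}$.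 It acts on $\ell^2(V)$ by the bounded operators $(Af)(x)=\sum_y A(x,y)f(y)$. Let $\mathrm{Tr}_G(A)=\lim_n |Q_n|^{-1}\sum_{x\in Q_n}A(x,x)$, where $(Q_n)$ is any Følner sequence (the limit exists and does not depend on the sequence). Let $H$ be the Hilbert space obtained from $P_G$ with the (semi-)inner product $\langle A,B\rangle=\mathrm{Tr}_G(B^*A)$ by dividing out the vectors of norm zero and completing, let $\psi_G(A)$ be the bounded operator on $H$ which extends left multiplication by $A$, let $N_G$ be the von Neumann algebra on $H$ generated by $\psi_G(P_G)$ (its weak closure), and let $\mathrm{Tr}_G(T)=\langle T1,1\rangle$ for $T\in N_G$. Let $B\in P_G$ be positive and self-adjoint as an operator on $\ell^2(V)$, with $B(x,y)\in\mathbb Q$ for all $x,y\in V$, and let $\sigma_B(\lambda)=\mathrm{Tr}_G\bigl(\chi_{(-\infty,\lambda]}(\psi_G(B))\bigr)$, $\lambda\in\mathbb R$, be the integrated density of states of $B$. Then every $\lambda$ at which $\sigma_B$ is discontinuous is an algebraic number. -/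

import Mathlib

open Filter Topology
open scoped InnerProductSpace ENNReal ComplexConjugate

noncomputable section

namespace AQ

/-! ### Balls, patterns, Følner sequences, AQ-graphs -/

/-- The vertex set of the ball of radius `r` around `x` for the shortest path distance. -/
def ball {V : Type*} (G : SimpleGraph V) (x : V) (r : ℕ) : Set V := {y | G.dist x y ≤ r}

theorem center_mem_ball {V : Type*} (G : SimpleGraph V) (x : V) (r : ℕ) : x ∈ ball G x r := by
  simp [ball]

/-- The isomorphisms from the ball of radius `r` around `x` to the one around `x'`
(balls are induced subgraphs). -/
abbrev BallIso {V : Type*} (G : SimpleGraph V) (r : ℕ) (x x' : V) : Type _ :=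
  G.induce (ball G x r) ≃g G.induce (ball G x' r)

/-- A ball isomorphism is rooted if it maps centre to centre. -/
def BallIso.IsRooted {V : Type*} {G : SimpleGraph V} {r : ℕ} {x x' : V}
    (φ : BallIso G r x x') : Prop :=
  (φ ⟨x, center_mem_ball G x r⟩ : V) = x'

/-- `x` and `y` have the same `r`-pattern: their rooted `r`-balls are isomorphic. -/
def SamePattern {V : Type*} (G : SimpleGraph V) (r : ℕ) (x y : V) : Prop :=
  ∃ φ : BallIso G r x y, BallIso.IsRooted φ

/-- The inner vertex boundary: vertices of `F` which have a neighbour outside `F`. -/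
def innerBoundary {V : Type*} (G : SimpleGraph V) (F : Finset V) : Set V :=
  {p | p ∈ F ∧ ∃ q, q ∉ F ∧ G.Adj p q}

/-- A Følner sequence: nonempty finite sets of vertices with `|∂Fₙ| / |Fₙ| → 0`. -/
def IsFolner {V : Type*} (G : SimpleGraph V) (F : ℕ → Finset V) : Prop :=
  (∀ n, (F n).Nonempty) ∧
    Tendsto (fun n => ((innerBoundary G (F n)).ncard : ℝ) / ((F n).card : ℝ)) atTop (𝓝 0)

/-- Abstract quasicrystal graphs: infinite connected amenable graphs of bounded degree in which
the pattern of every vertex `x` has, for every radius `r`, a frequency `p`, the same along all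
Følner sequences. -/
class IsAQGraph {V : Type*} (G : SimpleGraph V) : Prop where
  infinite : Infinite V
  connected : G.Connected
  bounded_degree : ∃ d : ℕ, ∀ v, (G.neighborSet v).encard ≤ d
  amenable : ∃ F : ℕ → Finset V, IsFolner G F
  frequency : ∀ (r : ℕ) (x : V), ∃ p : ℝ, ∀ Q : ℕ → Finset V, IsFolner G Q →
    Tendsto (fun n => (({y | y ∈ Q n ∧ SamePattern G r x y} : Set V).ncard : ℝ)
      / ((Q n).card : ℝ)) atTop (𝓝 p)

/-! ### Pattern-invariant matrices -/

/-- `A` vanishes at distance greater than `r`, and is invariant under rooted isomorphisms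
of `r`-balls. -/
def IsPatternInvariantWith {V : Type*} (G : SimpleGraph V) (r : ℕ) (A : V → V → ℂ) : Prop :=
  (∀ x y, r < G.dist x y → A x y = 0) ∧
    ∀ (x x' : V) (φ : BallIso G r x x'), BallIso.IsRooted φ →
      ∀ y : ball G x r, A x y = A x' (φ y)

/-- Pattern-invariant matrices. -/
def IsPatternInvariant {V : Type*} (G : SimpleGraph V) (A : V → V → ℂ) : Prop :=
  ∃ r : ℕ, IsPatternInvariantWith G r A

/-- The matrix product `(AB)(x,y) = ∑_z A(x,z) B(z,y)`. -/
def matMul {V : Type*} (A B : V → V → ℂ) : V → V → ℂ := fun x y => ∑ᶠ z, A x z * B z y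

/-- The adjoint matrix `A*(x,y) = conj A(y,x)`. -/
def matStar {V : Type*} (A : V → V → ℂ) : V → V → ℂ := fun x y => conj (A y x)

open Classical in
/-- The identity matrix. -/
def matOne {V : Type*} : V → V → ℂ := fun x y => if x = y then 1 else 0

section basic

variable {V : Type*} {G : SimpleGraph V}

theorem exists_pred (hG : G.Connected) {x y : V} {s : ℕ} (h : G.dist x y = s + 1) :
    ∃ z, G.dist x z = s ∧ G.Adj z y := by
  obtain ⟨p, hp⟩ := hG.exists_walk_length_eq_dist y x
  rw [SimpleGraph.dist_comm, h] at hp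
  cases p with
  | nil => simp at hp
  | @cons _ z _ hadj q =>
    refine ⟨z, ?_, hadj.symm⟩
    have h1 : G.dist z x ≤ q.length := SimpleGraph.dist_le q
    simp only [SimpleGraph.Walk.length_cons] at hp
    have h2 := hG.dist_triangle (u := x) (v := z) (w := y)
    have h3 : G.dist z y = 1 := SimpleGraph.dist_eq_one_iff_adj.2 hadj.symm
    rw [SimpleGraph.dist_comm] at h1
    omega

theorem iso_dist_le (hG : G.Connected) {R : ℕ} {x x' : V} (φ : BallIso G R x x') (s : ℕ) :
    ∀ (z y : ball G x R), G.dist x z + s ≤ R → G.dist (z : V) y ≤ s →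
      G.dist (φ z : V) (φ y) ≤ s := by
  induction s with
  | zero =>
    intro z y _ h
    have : (z : V) = y := hG.dist_eq_zero_iff.1 (by omega)
    rw [Subtype.ext this]; simp
  | succ s ih =>
    intro z y hz h
    by_cases h' : G.dist (z : V) y ≤ s
    · exact (ih z y (by omega) h').trans (by omega)
    · obtain ⟨w, hw, hwy⟩ := exists_pred hG (x := (z : V)) (y := y) (s := s) (by omega)
      have hwR : w ∈ ball G x R := by
        have := hG.dist_triangle (u := x) (v := (z : V)) (w := w)
        show G.dist x w ≤ R
        omega
      have h1 := ih z ⟨w, hwR⟩ (by omega) (by simp [hw])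
      have h2 : G.Adj (φ ⟨w, hwR⟩ : V) (φ y) := by
        have : (G.induce (ball G x R)).Adj ⟨w, hwR⟩ y := hwy
        exact (φ.map_rel_iff (a := ⟨w, hwR⟩) (b := y)).2 this
      have h3 : G.dist (φ ⟨w, hwR⟩ : V) (φ y) = 1 := SimpleGraph.dist_eq_one_iff_adj.2 h2
      have := hG.dist_triangle (u := (φ z : V)) (v := (φ ⟨w, hwR⟩ : V)) (w := (φ y : V))
      omega

theorem rooted_symm {R : ℕ} {x x' : V} {φ : BallIso G R x x'} (hφ : BallIso.IsRooted φ) :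
    BallIso.IsRooted (φ.symm : BallIso G R x' x) := by
  have : φ ⟨x, center_mem_ball G x R⟩ = ⟨x', center_mem_ball G x' R⟩ := Subtype.ext hφ
  show ((φ.symm ⟨x', center_mem_ball G x' R⟩ : ball G x R) : V) = x
  rw [← this]
  exact congrArg Subtype.val (φ.symm_apply_apply ⟨x, center_mem_ball G x R⟩)

theorem rooted_dist (hG : G.Connected) {R : ℕ} {x x' : V} {φ : BallIso G R x x'}
    (hφ : BallIso.IsRooted φ) (z : ball G x R) : G.dist x' (φ z) ≤ G.dist x z := by
  have := iso_dist_le hG φ (G.dist x z) ⟨x, center_mem_ball G x R⟩ z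
    (by have := z.2; simpa [ball] using this) le_rfl
  rwa [hφ] at this

theorem iso_dist_le_iff (hG : G.Connected) {R : ℕ} {x x' : V} {φ : BallIso G R x x'}
    (hφ : BallIso.IsRooted φ) {s : ℕ} (z y : ball G x R) (hz : G.dist x z + s ≤ R) :
    G.dist (φ z : V) (φ y) ≤ s ↔ G.dist (z : V) y ≤ s := by
  refine ⟨fun h => ?_, iso_dist_le hG φ s z y hz⟩
  have h1 := rooted_dist hG hφ z
  have := iso_dist_le hG (φ.symm : BallIso G R x' x) s (φ z) (φ y) (by omega) h
  rwa [RelIso.symm_apply_apply, RelIso.symm_apply_apply] at this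

theorem mem_big (hG : G.Connected) {R s : ℕ} {x z y : V} (hz : G.dist x z + s ≤ R)
    (hy : y ∈ ball G z s) : y ∈ ball G x R := by
  have := hG.dist_triangle (u := x) (v := z) (w := y)
  have hy' : G.dist z y ≤ s := hy
  show G.dist x y ≤ R
  omega

/-- A rooted ball isomorphism restricts to a rooted isomorphism of each smaller ball
inside. -/
theorem exists_restrict (hG : G.Connected) {R s : ℕ} {x x' : V} {φ : BallIso G R x x'}
    (hφ : BallIso.IsRooted φ) (z : ball G x R) (hz : G.dist x z + s ≤ R) :
    ∃ ψ : BallIso G s z (φ z), BallIso.IsRooted ψ ∧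
      ∀ y : ball G (z : V) s, (ψ y : V) = φ ⟨y, mem_big hG hz y.2⟩ := by
  have hz' : G.dist x' (φ z) + s ≤ R := by have := rooted_dist hG hφ z; omega
  have hback : ∀ y (hy : y ∈ ball G (φ z : V) s),
      (φ.symm ⟨y, mem_big hG hz' hy⟩ : V) ∈ ball G (z : V) s := by
    intro y hy
    have h : G.dist (φ z : V) (φ (φ.symm ⟨y, mem_big hG hz' hy⟩)) ≤ s := by
      rw [RelIso.apply_symm_apply]; exact hy
    exact (iso_dist_le_iff hG hφ z _ hz).1 h
  refine ⟨⟨⟨fun y => ⟨φ ⟨y, mem_big hG hz y.2⟩,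
      (iso_dist_le_iff hG hφ z ⟨y, mem_big hG hz y.2⟩ hz).2 y.2⟩,
      fun y => ⟨φ.symm ⟨y, mem_big hG hz' y.2⟩, hback y y.2⟩, ?_, ?_⟩, ?_⟩, ?_, ?_⟩
  · intro y; ext; simp
  · intro y; ext; simp
  · intro a b
    exact φ.map_rel_iff (a := ⟨a, mem_big hG hz a.2⟩) (b := ⟨b, mem_big hG hz b.2⟩)
  · rfl
  · intro y; rfl

theorem invariantWith_local (hG : G.Connected) {A : V → V → ℂ} {r R : ℕ}
    (hA : IsPatternInvariantWith G r A) {x x' : V} {φ : BallIso G R x x'}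
    (hφ : BallIso.IsRooted φ) (z y : ball G x R) (hz : G.dist x z + r ≤ R) :
    A z y = A (φ z) (φ y) := by
  by_cases h : G.dist (z : V) y ≤ r
  · obtain ⟨ψ, hψ, hψ'⟩ := exists_restrict hG hφ z hz
    have := hA.2 z (φ z) ψ hψ ⟨y, h⟩
    rw [hψ'] at this
    exact this
  · rw [hA.1 _ _ (by omega), hA.1 _ _ ]
    have := mt (iso_dist_le_iff hG hφ z y hz).1 h
    omega

theorem invariantWith_mono (hG : G.Connected) {A : V → V → ℂ} {r R : ℕ} (hr : r ≤ R)
    (hA : IsPatternInvariantWith G r A) : IsPatternInvariantWith G R A := by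
  refine ⟨fun x y h => hA.1 x y (by omega), fun x x' φ hφ y => ?_⟩
  have := invariantWith_local hG hA hφ ⟨x, center_mem_ball G x R⟩ y (by simpa using hr)
  rw [hφ] at this
  exact this

theorem invariant_zero : IsPatternInvariant G (0 : V → V → ℂ) :=
  ⟨0, by intros; rfl, by intros; rfl⟩

theorem invariant_add (hG : G.Connected) {A B : V → V → ℂ} (hA : IsPatternInvariant G A)
    (hB : IsPatternInvariant G B) : IsPatternInvariant G (A + B) := by
  obtain ⟨r, hr⟩ := hA
  obtain ⟨s, hs⟩ := hB
  have h1 := invariantWith_mono hG (le_max_left r s) hr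
  have h2 := invariantWith_mono hG (le_max_right r s) hs
  refine ⟨max r s, fun x y h => ?_, fun x x' φ hφ y => ?_⟩
  · simp [h1.1 x y h, h2.1 x y h]
  · simp [h1.2 x x' φ hφ y, h2.2 x x' φ hφ y]

theorem invariant_smul (c : ℂ) {A : V → V → ℂ} (hA : IsPatternInvariant G A) :
    IsPatternInvariant G (c • A) := by
  obtain ⟨r, hr⟩ := hA
  refine ⟨r, fun x y h => ?_, fun x x' φ hφ y => ?_⟩
  · simp [hr.1 x y h]
  · simp [hr.2 x x' φ hφ y]

theorem invariant_one (hG : G.Connected) : IsPatternInvariant G (matOne : V → V → ℂ) := by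
  refine ⟨0, fun x y h => ?_, fun x x' φ hφ y => ?_⟩
  · have : x ≠ y := by rintro rfl; simp at h
    simp [matOne, this]
  · have h0 : x = y := hG.dist_eq_zero_iff.1 (by have := y.2; simpa [ball] using this)
    have h1 : x' = φ y := hG.dist_eq_zero_iff.1 (by have := (φ y).2; simpa [ball] using this)
    simp only [matOne, if_pos h0, if_pos h1]

theorem invariant_star (hG : G.Connected) {A : V → V → ℂ} (hA : IsPatternInvariant G A) :
    IsPatternInvariant G (matStar A) := by
  obtain ⟨r, hr⟩ := hA
  refine ⟨r + r, fun x y h => ?_, fun x x' φ hφ y => ?_⟩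
  · simp only [matStar]
    rw [hr.1 y x (by rw [SimpleGraph.dist_comm]; omega), map_zero]
  · simp only [matStar]
    congr 1
    by_cases h : G.dist x y ≤ r
    · have := invariantWith_local hG hr hφ y ⟨x, center_mem_ball G x _⟩ (by omega)
      rw [hφ] at this
      exact this
    · have h2 := (iso_dist_le_iff hG hφ (s := r) ⟨x, center_mem_ball G x _⟩ y (by simp)).not.2 h
      rw [hφ] at h2
      rw [hr.1 y x (by rw [SimpleGraph.dist_comm]; omega),
        hr.1 (φ y) x' (by rw [SimpleGraph.dist_comm]; omega)]

theorem matMul_eq_ball {A : V → V → ℂ} {r : ℕ} (hA : ∀ x y, r < G.dist x y → A x y = 0)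
    (x : V) (f : V → ℂ) : ∑ᶠ z, A x z * f z = ∑ᶠ z : ball G x r, A x z * f z := by
  rw [finsum_set_coe_eq_finsum_mem (f := fun z => A x z * f z), finsum_mem_def]
  refine finsum_congr fun z => ?_
  by_cases h : z ∈ ball G x r
  · simp [h]
  · have : A x z = 0 := hA x z (by simpa [ball] using h)
    rw [this, zero_mul, Set.indicator_of_notMem h]

theorem invariant_mul (hG : G.Connected) {A B : V → V → ℂ} (hA : IsPatternInvariant G A)
    (hB : IsPatternInvariant G B) : IsPatternInvariant G (matMul A B) := by
  obtain ⟨r, hr⟩ := hA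
  obtain ⟨s, hs⟩ := hB
  refine ⟨r + s, fun x y h => ?_, fun x x' φ hφ y => ?_⟩
  · refine finsum_eq_zero_of_forall_eq_zero fun z => ?_
    by_cases h1 : r < G.dist x z
    · simp [hr.1 x z h1]
    · have := hG.dist_triangle (u := x) (v := z) (w := y)
      simp [hs.1 z y (by omega)]
  · simp only [matMul]
    rw [matMul_eq_ball hr.1 x (fun z => B z y), matMul_eq_ball hr.1 x' (fun z => B z (φ y))]
    obtain ⟨ψ, hψ, hψ'⟩ := exists_restrict hG hφ (s := r) ⟨x, center_mem_ball G x _⟩ (by simp)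
    revert ψ
    rw [hφ]
    intro ψ hψ hψ'
    refine finsum_eq_of_bijective ψ ψ.bijective fun z => ?_
    have hz : G.dist x z ≤ r := z.2
    rw [hr.2 x x' ψ hψ z, hψ' z,
      invariantWith_local hG hs hφ ⟨z, mem_big hG (by simp) z.2⟩ y (by simp only; omega)]

theorem samePattern_refl (G : SimpleGraph V) (r : ℕ) (x : V) : SamePattern G r x x :=
  ⟨SimpleGraph.Iso.refl, rfl⟩

theorem samePattern_symm (G : SimpleGraph V) {r : ℕ} {x y : V} : SamePattern G r x y → SamePattern G r y x :=
  fun ⟨φ, hφ⟩ => ⟨φ.symm, rooted_symm hφ⟩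

theorem samePattern_trans (G : SimpleGraph V) {r : ℕ} {x y z : V} :
    SamePattern G r x y → SamePattern G r y z → SamePattern G r x z := by
  rintro ⟨φ, hφ⟩ ⟨ψ, hψ⟩
  refine ⟨φ.trans ψ, ?_⟩
  have : φ ⟨x, center_mem_ball G x r⟩ = ⟨y, center_mem_ball G y r⟩ := Subtype.ext hφ
  show (ψ (φ ⟨x, center_mem_ball G x r⟩) : V) = z
  rw [this]; exact hψ

/-- The equivalence relation of having the same `r`-pattern. -/
def patternSetoid {V : Type*} (G : SimpleGraph V) (r : ℕ) : Setoid V where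
  r := SamePattern G r
  iseqv := ⟨samePattern_refl G r, samePattern_symm G, samePattern_trans G⟩

end basic

/-! ### Finiteness: balls and patterns -/

section finiteness

variable {V : Type*} (G : SimpleGraph V) [IsAQGraph G]

theorem ball_bound (r : ℕ) : ∃ N : ℕ, ∀ x, (ball G x r).encard ≤ N := by
  have hG : G.Connected := IsAQGraph.connected
  obtain ⟨d, hd⟩ := IsAQGraph.bounded_degree (G := G)
  induction r with
  | zero =>
    refine ⟨1, fun x => ?_⟩
    rw [Nat.cast_one, Set.encard_le_one_iff]
    intro a b ha hb
    have h1 : x = a := hG.dist_eq_zero_iff.1 (by simpa [ball] using ha)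
    have h2 : x = b := hG.dist_eq_zero_iff.1 (by simpa [ball] using hb)
    exact h1.symm.trans h2
  | succ r ih =>
    obtain ⟨N, hN⟩ := ih
    refine ⟨N + N * d, fun x => ?_⟩
    have hfin : (ball G x r).Finite := Set.finite_of_encard_le_coe (hN x)
    have hsub : ball G x (r + 1) ⊆
        ball G x r ∪ ⋃ z ∈ hfin.toFinset, G.neighborSet z := by
      intro y hy
      have hy' : G.dist x y ≤ r + 1 := hy
      by_cases h : G.dist x y ≤ r
      · exact Or.inl h
      · obtain ⟨z, hz, hzy⟩ := exists_pred hG (x := x) (y := y) (s := r) (by omega)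
        refine Or.inr ?_
        simp only [Set.mem_iUnion]
        refine ⟨z, ?_, hzy⟩
        simp [ball, hz]
    have hU : ∀ t : Finset V, (⋃ z ∈ t, G.neighborSet z).encard ≤ (t.card * d : ℕ) := by
      classical
      intro t
      induction t using Finset.induction_on with
      | empty => simp
      | insert a t ha ih =>
        rw [Finset.set_biUnion_insert, Finset.card_insert_of_notMem ha]
        refine (Set.encard_union_le _ _).trans ((add_le_add (hd a) ih).trans ?_)
        norm_cast
        apply le_of_eq
        ring
    have hcard : hfin.toFinset.card ≤ N := by
      have := hN x
      rw [hfin.encard_eq_coe_toFinset_card] at this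
      exact_mod_cast this
    refine (Set.encard_le_encard hsub).trans ((Set.encard_union_le _ _).trans ?_)
    push_cast
    refine add_le_add (hN x) ((hU _).trans ?_)
    exact_mod_cast Nat.mul_le_mul_right d hcard

theorem ball_finite (x : V) (r : ℕ) : (ball G x r).Finite := by
  obtain ⟨N, hN⟩ := ball_bound G r
  exact Set.finite_of_encard_le_coe (hN x)

theorem finite_patterns (r : ℕ) : Finite (Quotient (patternSetoid G r)) := by
  obtain ⟨N, hN⟩ := ball_bound G r
  have hc : ∀ x, (ball G x r).ncard < N + 1 := by
    intro x
    have := hN x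
    rw [← (ball_finite G x r).cast_ncard_eq] at this
    have : (ball G x r).ncard ≤ N := by exact_mod_cast this
    omega
  have e : ∀ x, ∃ n : Fin (N + 1), Nonempty (ball G x r ≃ Fin n) := fun x =>
    ⟨⟨(ball G x r).ncard, hc x⟩, by
      have := (ball_finite G x r).to_subtype
      exact ⟨Finite.equivFinOfCardEq rfl⟩⟩
  choose n hn using e
  let eq : ∀ x, ball G x r ≃ Fin (n x) := fun x => (hn x).some
  let code : V → Σ m : Fin (N + 1), SimpleGraph (Fin m) × Fin m := fun x =>
    ⟨n x, (G.induce (ball G x r)).map (eq x).toEmbedding, eq x ⟨x, center_mem_ball G x r⟩⟩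
  have key : ∀ x y, code x = code y → SamePattern G r x y := by
    intro x y h
    have aux : ∀ (m m' : Fin (N + 1)) (f : ball G x r ≃ Fin m) (g : ball G y r ≃ Fin m'),
        (⟨m, (G.induce (ball G x r)).map f.toEmbedding, f ⟨x, center_mem_ball G x r⟩⟩ :
          Σ m : Fin (N + 1), SimpleGraph (Fin m) × Fin m) =
        ⟨m', (G.induce (ball G y r)).map g.toEmbedding, g ⟨y, center_mem_ball G y r⟩⟩ →
        SamePattern G r x y := by
      intro m m' f g h
      obtain ⟨rfl, h⟩ := Sigma.mk.inj_iff.1 h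
      rw [heq_eq_eq, Prod.mk.injEq] at h
      obtain ⟨h1, h2⟩ := h
      refine ⟨⟨f.trans g.symm, ?_⟩, ?_⟩
      · intro a b
        have ha := congrArg (fun H : SimpleGraph _ => H.Adj (f a) (f b)) h1
        have h3 : ((G.induce (ball G x r)).map f.toEmbedding).Adj (f a) (f b) ↔
            (G.induce (ball G x r)).Adj a b :=
          SimpleGraph.map_adj_apply (f := f.toEmbedding)
        have h4 : ((G.induce (ball G y r)).map g.toEmbedding).Adj (g (g.symm (f a)))
            (g (g.symm (f b))) ↔ (G.induce (ball G y r)).Adj (g.symm (f a)) (g.symm (f b)) :=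
          SimpleGraph.map_adj_apply (f := g.toEmbedding)
        rw [g.apply_symm_apply, g.apply_symm_apply] at h4
        exact h4.symm.trans ((iff_of_eq ha).symm.trans h3)
      · show ((g.symm (f ⟨x, center_mem_ball G x r⟩) : ball G y r) : V) = y
        rw [h2, g.symm_apply_apply]
    exact aux _ _ _ _ h
  have : ∀ m : ℕ, Finite (SimpleGraph (Fin m)) := fun m => inferInstance
  refine Finite.of_injective (fun q : Quotient (patternSetoid G r) => code q.out) ?_
  intro a b h
  rw [← Quotient.out_eq a, ← Quotient.out_eq b]
  exact Quotient.sound (key _ _ h)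

/-- Entries of a pattern-invariant matrix are bounded. -/
theorem entries_bound {A : V → V → ℂ} (hA : IsPatternInvariant G A) :
    ∃ M : ℝ, 0 ≤ M ∧ ∀ x y, ‖A x y‖ ≤ M := by
  obtain ⟨r, hr⟩ := hA
  have := finite_patterns G r
  have := Fintype.ofFinite (Quotient (patternSetoid G r))
  refine ⟨∑ q : Quotient (patternSetoid G r), ∑ y ∈ (ball_finite G q.out r).toFinset,
    ‖A q.out y‖, by positivity, fun x y => ?_⟩
  by_cases h : y ∈ ball G x r
  · obtain ⟨φ, hφ⟩ : SamePattern G r x (Quotient.mk (patternSetoid G r) x).out :=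
      samePattern_symm G (Quotient.mk_out (s := patternSetoid G r) x)
    have h1 := hr.2 _ _ φ hφ ⟨y, h⟩
    simp only at h1
    rw [h1]
    refine le_trans ?_ (Finset.single_le_sum (fun q _ => by positivity)
      (Finset.mem_univ (Quotient.mk (patternSetoid G r) x)))
    exact Finset.single_le_sum (f := fun y => ‖A (Quotient.mk (patternSetoid G r) x).out y‖)
      (fun q _ => by positivity) (by simp)
  · rw [hr.1 x y (by simpa [ball] using h), norm_zero]
    positivity

/-- Averages of functions of the pattern converge along all Følner sequences, to one limit. -/
theorem exists_average {r : ℕ} {f : V → ℂ} (hf : ∀ x y, SamePattern G r x y → f x = f y) :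
    ∃ t : ℂ, ∀ Q : ℕ → Finset V, IsFolner G Q →
      Tendsto (fun n => (∑ x ∈ Q n, f x) / ((Q n).card : ℂ)) atTop (𝓝 t) := by
  classical
  have := finite_patterns G r
  have := Fintype.ofFinite (Quotient (patternSetoid G r))
  choose p hp using IsAQGraph.frequency (G := G) r
  refine ⟨∑ q : Quotient (patternSetoid G r), f q.out * (p q.out : ℂ), fun Q hQ => ?_⟩
  have hlim : Tendsto (fun n => ∑ q : Quotient (patternSetoid G r), f q.out *
      (((({y | y ∈ Q n ∧ SamePattern G r q.out y} : Set V).ncard : ℝ)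
        / ((Q n).card : ℝ) : ℝ) : ℂ)) atTop
      (𝓝 (∑ q : Quotient (patternSetoid G r), f q.out * (p q.out : ℂ))) :=
    tendsto_finsetSum _ fun q _ => tendsto_const_nhds.mul
      ((Complex.continuous_ofReal.tendsto _).comp (hp q.out Q hQ))
  refine hlim.congr fun n => ?_
  rw [← Finset.sum_fiberwise (Q n) (fun x => Quotient.mk (patternSetoid G r) x) f,
    Finset.sum_div]
  refine Finset.sum_congr rfl fun q _ => ?_
  have hset : ({y | y ∈ Q n ∧ SamePattern G r q.out y} : Set V) =
      ((Q n).filter fun x => Quotient.mk (patternSetoid G r) x = q : Finset V) := by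
    ext y
    simp only [Set.mem_ofPred_eq, Finset.coe_filter]
    refine and_congr_right fun _ => ?_
    rw [Quotient.mk_eq_iff_out]
    exact ⟨samePattern_symm G, samePattern_symm G⟩
  rw [hset, Set.ncard_coe_finset]
  have : ∑ x ∈ (Q n).filter (fun x => Quotient.mk (patternSetoid G r) x = q), f x =
      ∑ x ∈ (Q n).filter (fun x => Quotient.mk (patternSetoid G r) x = q), f q.out := by
    refine Finset.sum_congr rfl fun x hx => hf _ _ ?_
    have := (Finset.mem_filter.1 hx).2
    exact Quotient.mk_eq_iff_out.1 this
  rw [this, Finset.sum_const, nsmul_eq_mul]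
  push_cast
  ring

end finiteness

/-! ### The algebra of pattern-invariant matrices and its trace -/

section algebra

variable {V : Type*} (G : SimpleGraph V) [IsAQGraph G]

/-- The pattern-invariant matrices as a linear subspace of all matrices. -/
def patternSubmodule : Submodule ℂ (V → V → ℂ) where
  carrier := {A | IsPatternInvariant G A}
  add_mem' := invariant_add IsAQGraph.connected
  zero_mem' := invariant_zero
  smul_mem' c _ := invariant_smul c

/-- The algebra `P_G` of pattern-invariant matrices. -/
def PatternAlgebra : Type _ := patternSubmodule G

instance : AddCommGroup (PatternAlgebra G) := inferInstanceAs (AddCommGroup (patternSubmodule G))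

instance : Module ℂ (PatternAlgebra G) := inferInstanceAs (Module ℂ (patternSubmodule G))

instance : CoeFun (PatternAlgebra G) fun _ => V → V → ℂ := ⟨fun A => A.1⟩

instance : Mul (PatternAlgebra G) :=
  ⟨fun A B => ⟨matMul A B, invariant_mul IsAQGraph.connected A.2 B.2⟩⟩

instance : Star (PatternAlgebra G) :=
  ⟨fun A => ⟨matStar A, invariant_star IsAQGraph.connected A.2⟩⟩

instance : One (PatternAlgebra G) := ⟨⟨matOne, invariant_one IsAQGraph.connected⟩⟩

variable {G}

theorem add_apply (A B : PatternAlgebra G) (x y : V) : (A + B) x y = A x y + B x y := rfl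

theorem smul_apply (c : ℂ) (A : PatternAlgebra G) (x y : V) : (c • A) x y = c * A x y := rfl

theorem mul_apply (A B : PatternAlgebra G) (x y : V) : (A * B) x y = ∑ᶠ z, A x z * B z y := rfl

theorem star_apply (A : PatternAlgebra G) (x y : V) : (star A) x y = conj (A y x) := rfl

@[ext]
theorem PatternAlgebra.ext {A B : PatternAlgebra G} (h : ∀ x y, A x y = B x y) : A = B :=
  Subtype.ext (funext fun x => funext fun y => h x y)

theorem row_finite (A : PatternAlgebra G) (x : V) : (Function.support (A x)).Finite := by
  obtain ⟨r, hr⟩ := A.2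
  refine (ball_finite G x r).subset fun y hy => ?_
  by_contra h
  exact hy (hr.1 x y (by simpa [ball] using h))

theorem col_finite (A : PatternAlgebra G) (x : V) :
    (Function.support fun y => A y x).Finite := by
  refine (row_finite (star A) x).subset fun y hy => ?_
  simpa [star_apply] using hy

theorem row_mul_finite (A : PatternAlgebra G) (x : V) (f : V → ℂ) :
    (Function.support fun z => A x z * f z).Finite :=
  (row_finite A x).subset fun _ hy => left_ne_zero_of_mul hy

theorem mul_add' (A B C : PatternAlgebra G) : A * (B + C) = A * B + A * C := by
  ext x y
  simp only [mul_apply, add_apply, mul_add]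
  exact finsum_add_distrib (row_mul_finite A x _) (row_mul_finite A x _)

theorem add_mul' (A B C : PatternAlgebra G) : (A + B) * C = A * C + B * C := by
  ext x y
  simp only [mul_apply, add_apply, add_mul]
  exact finsum_add_distrib (row_mul_finite A x _) (row_mul_finite B x _)

theorem smul_mul' (c : ℂ) (A B : PatternAlgebra G) : (c • A) * B = c • (A * B) := by
  ext x y
  simp only [mul_apply, smul_apply, mul_assoc]
  exact (smul_finsum c fun z => A x z * B z y).symm

theorem mul_smul' (c : ℂ) (A B : PatternAlgebra G) : A * (c • B) = c • (A * B) := by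
  ext x y
  simp only [mul_apply, smul_apply, mul_left_comm _ c]
  exact (smul_finsum c fun z => A x z * B z y).symm

theorem star_add' (A B : PatternAlgebra G) : star (A + B) = star A + star B := by
  ext x y
  simp [star_apply, add_apply]

theorem star_smul' (c : ℂ) (A : PatternAlgebra G) : star (c • A) = conj c • star A := by
  ext x y
  simp [star_apply, smul_apply]

theorem conj_star_mul_apply (A B : PatternAlgebra G) (x y : V) :
    conj ((star B * A) y x) = (star A * B) x y := by
  have h := map_finsum (starRingEnd ℂ) (f := fun z => conj (B z y) * A z x)
    (row_mul_finite (star B) y fun z => A z x)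
  simp only [mul_apply, star_apply]
  refine h.trans (finsum_congr fun z => ?_)
  simp [mul_comm]

variable (G)

/-- Trace averages converge along all Følner sequences, to one limit. -/
theorem exists_trace (A : PatternAlgebra G) : ∃ t : ℂ, ∀ Q : ℕ → Finset V, IsFolner G Q →
    Tendsto (fun n => (∑ x ∈ Q n, A x x) / ((Q n).card : ℂ)) atTop (𝓝 t) := by
  obtain ⟨r, hr⟩ := A.2
  refine exists_average G (r := r) fun x y ⟨φ, hφ⟩ => ?_
  have := hr.2 x y φ hφ ⟨x, center_mem_ball G x r⟩
  rw [hφ] at this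
  exact this

variable {G}

/-- The trace `Tr_G(A)`: the common limit of `|Qₙ|⁻¹ ∑_{x ∈ Qₙ} A(x,x)` over all Følner
sequences. -/
def trace (A : PatternAlgebra G) : ℂ := (exists_trace G A).choose

theorem trace_tendsto (A : PatternAlgebra G) {Q : ℕ → Finset V} (hQ : IsFolner G Q) :
    Tendsto (fun n => (∑ x ∈ Q n, A x x) / ((Q n).card : ℂ)) atTop (𝓝 (trace A)) :=
  (exists_trace G A).choose_spec Q hQ

theorem trace_add (A B : PatternAlgebra G) : trace (A + B) = trace A + trace B := by
  obtain ⟨Q, hQ⟩ := IsAQGraph.amenable (G := G)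
  refine tendsto_nhds_unique (trace_tendsto (A + B) hQ)
    (((trace_tendsto A hQ).add (trace_tendsto B hQ)).congr fun n => ?_)
  simp only [add_apply, Finset.sum_add_distrib, add_div]

theorem trace_smul (c : ℂ) (A : PatternAlgebra G) : trace (c • A) = c * trace A := by
  obtain ⟨Q, hQ⟩ := IsAQGraph.amenable (G := G)
  refine tendsto_nhds_unique (trace_tendsto (c • A) hQ)
    (((trace_tendsto A hQ).const_mul c).congr fun n => ?_)
  simp only [smul_apply, ← Finset.mul_sum, mul_div_assoc]

theorem conj_trace (A B : PatternAlgebra G) :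
    conj (trace (star B * A)) = trace (star A * B) := by
  obtain ⟨Q, hQ⟩ := IsAQGraph.amenable (G := G)
  refine tendsto_nhds_unique (((Complex.continuous_conj.tendsto _).comp
    (trace_tendsto (star B * A) hQ)).congr fun n => ?_) (trace_tendsto (star A * B) hQ)
  simp only [Function.comp, map_div₀, map_sum, conj_star_mul_apply, Complex.conj_natCast]

theorem re_trace_le {A B : PatternAlgebra G} {c : ℝ}
    (h : ∀ x, (A x x).re ≤ c * (B x x).re) : (trace A).re ≤ c * (trace B).re := by
  obtain ⟨Q, hQ⟩ := IsAQGraph.amenable (G := G)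
  refine le_of_tendsto_of_tendsto' ((Complex.continuous_re.tendsto _).comp (trace_tendsto A hQ))
    (((Complex.continuous_re.tendsto _).comp (trace_tendsto B hQ)).const_mul c) fun n => ?_
  simp only [Function.comp, Complex.div_natCast_re, Complex.re_sum]
  rw [← mul_div_assoc, Finset.mul_sum]
  gcongr with x
  exact h x

theorem star_mul_self_diag (A : PatternAlgebra G) (x : V) :
    (star A * A) x x = ((∑ z ∈ (col_finite A x).toFinset, ‖A z x‖ ^ 2 : ℝ) : ℂ) := by
  rw [mul_apply, finsum_eq_sum_of_support_subset (s := (col_finite A x).toFinset)]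
  · push_cast
    refine Finset.sum_congr rfl fun z _ => ?_
    rw [star_apply, Complex.conj_mul']
  · intro z hz
    simpa using right_ne_zero_of_mul hz

theorem re_trace_star_mul_self_nonneg (A : PatternAlgebra G) : 0 ≤ (trace (star A * A)).re := by
  have := re_trace_le (A := (0 : PatternAlgebra G)) (B := star A * A) (c := 1) (fun x => by
    rw [star_mul_self_diag, Complex.ofReal_re]
    show (0 : ℂ).re ≤ _
    rw [Complex.zero_re]
    positivity)
  have h0 : trace (0 : PatternAlgebra G) = 0 := by
    have := trace_smul 0 (0 : PatternAlgebra G)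
    rwa [zero_smul, zero_mul] at this
  rwa [h0, Complex.zero_re, one_mul] at this

/-- The basic `ℓ²` estimate for a pattern-invariant matrix. -/
theorem schur (A : PatternAlgebra G) : ∃ K : ℝ, 0 ≤ K ∧ ∀ (f : V → ℂ) (s : Finset V),
    ∃ t : Finset V, ∑ x ∈ s, ‖∑ᶠ z, A x z * f z‖ ^ 2 ≤ K ^ 2 * ∑ z ∈ t, ‖f z‖ ^ 2 := by
  classical
  obtain ⟨M, hM, hAM⟩ := entries_bound G A.2
  obtain ⟨r, hr⟩ := A.2
  obtain ⟨N, hN⟩ := ball_bound G r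
  let b : V → Finset V := fun x => (ball_finite G x r).toFinset
  have hb : ∀ x, (b x).card ≤ N := fun x => by
    have := hN x
    rw [(ball_finite G x r).encard_eq_coe_toFinset_card] at this
    exact_mod_cast this
  have hmem : ∀ x z, z ∈ b x ↔ G.dist x z ≤ r := fun x z => by simp [b, ball]
  refine ⟨M * N, by positivity, fun f s => ⟨s.biUnion b, ?_⟩⟩
  have h1 : ∀ x, ‖∑ᶠ z, A x z * f z‖ ^ 2 ≤ M ^ 2 * N * ∑ z ∈ b x, ‖f z‖ ^ 2 := by
    intro x
    rw [finsum_eq_sum_of_support_subset (s := b x) _ (by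
      intro z hz
      rw [Finset.mem_coe, hmem]
      by_contra h
      exact left_ne_zero_of_mul hz (hr.1 x z (by omega)))]
    calc ‖∑ z ∈ b x, A x z * f z‖ ^ 2 ≤ (∑ z ∈ b x, M * ‖f z‖) ^ 2 := by
          gcongr
          refine (norm_sum_le _ _).trans (Finset.sum_le_sum fun z _ => ?_)
          rw [norm_mul]
          gcongr
          exact hAM x z
      _ = M ^ 2 * (∑ z ∈ b x, ‖f z‖) ^ 2 := by rw [← Finset.mul_sum, mul_pow]
      _ ≤ M ^ 2 * ((b x).card * ∑ z ∈ b x, ‖f z‖ ^ 2) := by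
          gcongr
          exact sq_sum_le_card_mul_sum_sq
      _ ≤ M ^ 2 * (N * ∑ z ∈ b x, ‖f z‖ ^ 2) := by
          gcongr
          exact hb x
      _ = _ := by ring
  have h2 : ∑ x ∈ s, ∑ z ∈ b x, ‖f z‖ ^ 2 ≤ N * ∑ z ∈ s.biUnion b, ‖f z‖ ^ 2 := by
    have : ∀ x ∈ s, ∑ z ∈ b x, ‖f z‖ ^ 2 =
        ∑ z ∈ s.biUnion b, if x ∈ b z then ‖f z‖ ^ 2 else 0 := by
      intro x hx
      rw [← Finset.sum_filter]
      refine Finset.sum_congr ?_ fun _ _ => rfl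
      ext z
      simp only [Finset.mem_filter, Finset.mem_biUnion]
      constructor
      · intro h
        exact ⟨⟨x, hx, h⟩, by rw [hmem] at h ⊢; rwa [SimpleGraph.dist_comm]⟩
      · rintro ⟨-, h⟩
        rw [hmem] at h ⊢
        rwa [SimpleGraph.dist_comm]
    rw [Finset.sum_congr rfl this, Finset.sum_comm, Finset.mul_sum]
    refine Finset.sum_le_sum fun z _ => ?_
    rw [← Finset.sum_filter, Finset.sum_const, nsmul_eq_mul]
    gcongr
    refine (Finset.card_le_card ?_).trans (hb z)
    intro x hx
    exact (Finset.mem_filter.1 hx).2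
  calc ∑ x ∈ s, ‖∑ᶠ z, A x z * f z‖ ^ 2
      ≤ ∑ x ∈ s, M ^ 2 * N * ∑ z ∈ b x, ‖f z‖ ^ 2 := Finset.sum_le_sum fun x _ => h1 x
    _ = M ^ 2 * N * ∑ x ∈ s, ∑ z ∈ b x, ‖f z‖ ^ 2 := by rw [Finset.mul_sum]
    _ ≤ M ^ 2 * N * (N * ∑ z ∈ s.biUnion b, ‖f z‖ ^ 2) := by gcongr
    _ = _ := by ring

end algebra

/-! ### The representation on `ℓ²(V)` -/

section l2

variable {V : Type*} {G : SimpleGraph V} [IsAQGraph G]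

theorem l2_aux (A : PatternAlgebra G) : ∃ K : ℝ, 0 ≤ K ∧
    ∀ (f : lp (fun _ : V => ℂ) 2) (s : Finset V),
      ∑ x ∈ s, ‖∑ᶠ z, A x z * f z‖ ^ (2 : ℝ≥0∞).toReal ≤ (K * ‖f‖) ^ (2 : ℝ≥0∞).toReal := by
  obtain ⟨K, hK, h⟩ := schur A
  refine ⟨K, hK, fun f s => ?_⟩
  obtain ⟨t, ht⟩ := h f s
  have h2 := lp.sum_rpow_le_norm_rpow (p := 2) (by norm_num) f t
  simp only [ENNReal.toReal_ofNat, Real.rpow_ofNat] at h2 ⊢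
  rw [mul_pow]
  exact ht.trans (by gcongr)

/-- The bounded operator on `ℓ²(V)` given by a pattern-invariant matrix,
`(Af)(x) = ∑_y A(x,y) f(y)`. -/
def l2Op (A : PatternAlgebra G) : lp (fun _ : V => ℂ) 2 →L[ℂ] lp (fun _ : V => ℂ) 2 :=
  LinearMap.mkContinuousOfExistsBound
    { toFun := fun f => ⟨fun x => ∑ᶠ y, A x y * f y,
        let ⟨_, _, h⟩ := l2_aux A
        memℓp_gen' (h f)⟩
      map_add' := fun f g => by
        ext x
        simp only [lp.coeFn_add, Pi.add_apply, mul_add]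
        exact finsum_add_distrib (row_mul_finite A x _) (row_mul_finite A x _)
      map_smul' := fun c f => by
        ext x
        simp only [lp.coeFn_smul, Pi.smul_apply, smul_eq_mul, mul_left_comm _ c, RingHom.id_apply]
        exact (smul_finsum c fun z => A x z * f z).symm }
    (let ⟨K, hK, h⟩ := l2_aux A
     ⟨K, fun f => lp.norm_le_of_forall_sum_le (by norm_num) (by positivity) (h f)⟩)

theorem l2Op_apply (A : PatternAlgebra G) (f : lp (fun _ : V => ℂ) 2) (x : V) :
    l2Op A f x = ∑ᶠ y, A x y * f y := rfl

end l2

/-! ### The GNS construction and the pattern-frequency von Neumann algebra -/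

section gns

variable {V : Type*} (G : SimpleGraph V) [IsAQGraph G]

/-- The (semi-)inner product `Tr_G(A* B)` on `P_G`; it is conjugate-linear in `A`. -/
abbrev preInnerCore : PreInnerProductSpace.Core ℂ (PatternAlgebra G) where
  inner A B := trace (star A * B)
  conj_inner_symm A B := conj_trace A B
  re_inner_nonneg A := re_trace_star_mul_self_nonneg A
  add_left A B C := by rw [star_add', add_mul', trace_add]
  smul_left A B c := by rw [star_smul', smul_mul', trace_smul]

instance : SeminormedAddCommGroup (PatternAlgebra G) :=
  InnerProductSpace.Core.toSeminormedAddCommGroup (c := preInnerCore G)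

instance : InnerProductSpace ℂ (PatternAlgebra G) :=
  InnerProductSpace.ofCore (preInnerCore G)

theorem inner_def (A B : PatternAlgebra G) : ⟪A, B⟫_ℂ = trace (star A * B) := rfl

theorem norm_def (A : PatternAlgebra G) : ‖A‖ = √(trace (star A * A)).re := rfl

/-- The Hilbert space of the GNS construction: the Hausdorff completion of `P_G` for the inner
product given by the trace. -/
abbrev GNS : Type _ := UniformSpace.Completion (PatternAlgebra G)

variable {G}

theorem leftMul_bound (B : PatternAlgebra G) :
    ∃ K : ℝ, ∀ A : PatternAlgebra G, ‖B * A‖ ≤ K * ‖A‖ := by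
  obtain ⟨K, hK, h⟩ := schur B
  refine ⟨K, fun A => ?_⟩
  rw [norm_def, norm_def, Real.sqrt_le_left (by positivity), mul_pow,
    Real.sq_sqrt (re_trace_star_mul_self_nonneg A)]
  refine re_trace_le fun x => ?_
  rw [star_mul_self_diag, star_mul_self_diag, Complex.ofReal_re, Complex.ofReal_re]
  obtain ⟨t, ht⟩ := h (fun z => A z x) (col_finite (B * A) x).toFinset
  refine ht.trans (mul_le_mul_of_nonneg_left ?_ (by positivity))
  classical
  refine (Finset.sum_le_sum_of_subset_of_nonneg
    (Finset.subset_union_left (s₂ := (col_finite A x).toFinset)) fun _ _ _ => by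
      positivity).trans (le_of_eq (Finset.sum_subset Finset.subset_union_right ?_).symm)
  intro z _ hz
  have : A z x = 0 := by simpa using hz
  simp [this]

/-- Left multiplication `A ↦ BA` on the pre-Hilbert space `P_G`. -/
def leftMul (B : PatternAlgebra G) : PatternAlgebra G →L[ℂ] PatternAlgebra G :=
  LinearMap.mkContinuousOfExistsBound
    { toFun := fun A => B * A
      map_add' := mul_add' B
      map_smul' := fun c A => mul_smul' c B A } (leftMul_bound B)

/-- The GNS representation: left multiplication extended to the Hilbert space. -/
def gnsRep (B : PatternAlgebra G) : GNS G →L[ℂ] GNS G := (leftMul B).completion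

theorem gnsRep_coe (B A : PatternAlgebra G) : gnsRep B (A : GNS G) = ((B * A : PatternAlgebra G) : GNS G) :=
  ContinuousLinearMap.completion_apply_coe _ _

variable (G)

/-- The pattern-frequency algebra `N_G`: the von Neumann algebra on the GNS Hilbert space generated
by the `*`-algebra of left multiplications. It is given as the double commutant, which is the
weak closure because the `*`-algebra contains the identity operator. -/
def patternVN : VonNeumannAlgebra (GNS G) where
  toStarSubalgebra := StarSubalgebra.centralizer ℂ
    (StarSubalgebra.centralizer ℂ (Set.range (gnsRep (G := G))) : Set (GNS G →L[ℂ] GNS G))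
  centralizer_centralizer' := by
    simp

variable {G}

/-- The embedding `ψ_G : P_G → N_G`. -/
def psi (B : PatternAlgebra G) : patternVN G :=
  ⟨gnsRep B, StarAlgebra.adjoin_le_centralizer_centralizer ℂ _
    (StarAlgebra.subset_adjoin ℂ _ ⟨B, rfl⟩)⟩

/-- The trace `T ↦ ⟨T 1, 1⟩` on `N_G` (the inner product is linear in its second argument
here), which extends `Tr_G`. -/
def vnTrace (T : patternVN G) : ℂ :=
  ⟪((1 : PatternAlgebra G) : GNS G), (T : GNS G →L[ℂ] GNS G) ((1 : PatternAlgebra G) : GNS G)⟫_ℂ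

end gns

/-! ### Spectral projections and the integrated density of states -/

section spectral

/-- The spectral projection `χ_{(-∞, c]}(T)` of a self-adjoint operator `T`: the orthogonal
projection onto the kernel of the positive part `(T - c)⁺`. -/
def spectralProjection {H : Type*} [NormedAddCommGroup H] [InnerProductSpace ℂ H] [CompleteSpace H]
    (T : H →L[ℂ] H) (c : ℝ) : H →L[ℂ] H :=
  (cfc (fun t : ℝ => max (t - c) 0) T).ker.starProjection

/-- Spectral projections of an element of a von Neumann algebra belong to the algebra. -/
theorem spectralProjection_mem {H : Type*} [NormedAddCommGroup H] [InnerProductSpace ℂ H]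
    [CompleteSpace H] (S : VonNeumannAlgebra H) {T : H →L[ℂ] H} (hT : T ∈ S) (c : ℝ) :
    spectralProjection T c ∈ S := by
  unfold spectralProjection
  rw [VonNeumannAlgebra.IsStarProjection.mem_iff (isStarProjection_starProjection)]
  intro y hy
  have hcomm : Commute T y := VonNeumannAlgebra.mem_commutant_iff.1 hy T hT
  have h2 := hcomm.cfc_real (fun t : ℝ => max (t - c) 0)
  rw [Submodule.range_starProjection, Module.End.mem_invtSubmodule]
  intro v hv
  have hv' : cfc (fun t : ℝ => max (t - c) 0) T v = 0 := hv
  show cfc (fun t : ℝ => max (t - c) 0) T (y v) = 0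
  have := congrArg (fun L : H →L[ℂ] H => L v) h2.eq
  simp only [mul_apply_eq_comp, hv', map_zero] at this
  exact this

variable {V : Type*} {G : SimpleGraph V} [IsAQGraph G]

/-- The integrated density of states `σ_B(c) = Tr_G(E^B_c)`, where `E^B_c` is the spectral
projection `χ_{(-∞, c]}(ψ_G(B)) ∈ N_G`. -/
def ids (B : PatternAlgebra G) (c : ℝ) : ℝ :=
  (vnTrace (G := G) ⟨spectralProjection (psi B : GNS G →L[ℂ] GNS G) c,
    spectralProjection_mem (patternVN G) (psi B).2 c⟩).re

end spectral

end AQ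
end

/-! ### Real-rooted integer polynomials: how many roots can lie near a transcendental number -/

namespace AQ
open Polynomial

/-! The argument is by contradiction: a jump of the density of states at a transcendental `c` would
force finite compressions of `B` to have a positive proportion of eigenvalues arbitrarily near `c`,
which arithmetic forbids.

Analytic side. A jump at `c` gives one `δ > 0` with `Tr(p(B)* p(B)) ≥ δ` for every polynomial `p`
with `p(c) = 1` (`exists_le_norm_sq_of_not_continuousAt`). For a finite set `Q`, the sum of the
diagonal of `p(B)* p(B)` over `Q` is at most the sum of `|p(λ)|²` over the eigenvalues `λ` of the
compression of `B` to `Q`, plus a constant depending on `p` times the size of the boundary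
(`exists_trace_polyEval_bound`). Along a Følner sequence the boundary disappears. If `p` is a bump
at `c`, the trace is therefore controlled by the proportion of eigenvalues within `ε` of `c`.

Arithmetic side. `B` has finitely many distinct entries, hence a common denominator `D`, and `D`
times a compression has a monic integer characteristic polynomial with real roots in a fixed
interval. Only a small proportion of such roots can lie near a transcendental number
(`exists_small_clusters`). An irreducible factor of small degree is one of finitely many
polynomials, so its roots keep a fixed distance from the number. An irreducible factor of large
degree has nonzero integer discriminant, of absolute value at least 1; a large cluster of roots
would make it smaller than 1. The resulting `ε` does not depend on `Q`, so the trace can be made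
less than `δ`. -/

theorem one_le_prod_abs_eval_derivative {p : ℤ[X]} (hp : p.Monic)
    (hs : (p.map (Int.castRingHom ℝ)).Splits) (hsep : (p.map (Int.castRingHom ℝ)).Separable) :
    1 ≤ ((p.map (Int.castRingHom ℝ)).roots.map
      fun a => |(derivative (p.map (Int.castRingHom ℝ))).eval a|).prod := by
  set P := p.map (Int.castRingHom ℝ) with hP
  -- The product is, up to sign, the resultant of `p` and `p'`: an integer, and nonzero by
  -- separability, so at least 1 in absolute value.
  have h1 := resultant_eq_prod_eval P (derivative P) (derivative p).natDegree
    (by rw [hP, derivative_map]; exact natDegree_map_le) hs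
  rw [(hp.map _).leadingCoeff, one_pow, one_mul] at h1
  have h2 := resultant_map_map p (derivative p) p.natDegree (derivative p).natDegree
    (Int.castRingHom ℝ)
  rw [← derivative_map, ← hP, ← hp.natDegree_map (Int.castRingHom ℝ), ← hP, h1] at h2
  have h3 : (P.roots.map fun a => |(derivative P).eval a|).prod
      = |(P.roots.map fun a => (derivative P).eval a).prod| := by
    exact Multiset.prod_hom' P.roots (absHom : ℝ →*₀ ℝ) fun a => (derivative P).eval a
  rw [h3, h2]
  have h4 : (P.roots.map fun a => (derivative P).eval a).prod ≠ 0 := by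
    rw [Ne, Multiset.prod_eq_zero_iff, Multiset.mem_map]
    rintro ⟨a, ha, ha'⟩
    have := hsep.aeval_derivative_ne_zero (x := a) (by simpa using (mem_roots'.1 ha).2)
    simp [ha'] at this
  rw [h2] at h4
  have h5 : resultant p (derivative p) P.natDegree (derivative p).natDegree ≠ 0 := by
    intro h; rw [h] at h4; simp at h4
  rw [eq_intCast, ← Int.cast_abs]
  exact_mod_cast Int.one_le_abs h5

/-- Gauss's lemma carries irreducibility to `ℚ`, where characteristic zero gives separability, which
survives the extension to `ℝ`. -/
theorem separable_map_real_of_irreducible {p : ℤ[X]} (hp : p.Monic) (hirr : Irreducible p) :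
    (p.map (Int.castRingHom ℝ)).Separable := by
  have h1 : Irreducible (p.map (algebraMap ℤ ℚ)) :=
    (hp.irreducible_iff_irreducible_map_fraction_map (K := ℚ)).1 hirr
  have h2 := h1.separable.map (f := algebraMap ℚ ℝ)
  rw [Polynomial.map_map] at h2
  rwa [RingHom.ext_int (Int.castRingHom ℝ) ((algebraMap ℚ ℝ).comp (algebraMap ℤ ℚ))]

/-- The roots of an irreducible monic integer polynomial do not cluster. -/
theorem one_le_cluster_bound {p : ℤ[X]} (hp : p.Monic) (hirr : Irreducible p)
    (hs : (p.map (Int.castRingHom ℝ)).Splits) {K ε c : ℝ} (hK : 0 ≤ K) (hε : 0 < ε)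
    (hε' : 2 * ε ≤ 1) (hroot : ∀ a ∈ (p.map (Int.castRingHom ℝ)).roots, |a| ≤ K) {m : ℕ}
    (hm : ((p.map (Int.castRingHom ℝ)).roots.filter fun a => |a - c| < ε).card = m) :
    1 ≤ (2 * ε) ^ (m * (m - 1)) * (2 * K + 1) ^ (p.natDegree * p.natDegree) := by
  classical
  have hsep := separable_map_real_of_irreducible hp hirr
  have h1 := one_le_prod_abs_eval_derivative hp hs hsep
  set P := p.map (Int.castRingHom ℝ) with hP
  have hnd : P.roots.Nodup := nodup_roots hsep
  let S : Finset ℝ := ⟨P.roots, hnd⟩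
  let T : Finset ℝ := S.filter fun a => |a - c| < ε
  have hT : T.card = m := by rw [← hm]; rfl
  have hS : S.card = p.natDegree := by
    rw [← hp.natDegree_map (Int.castRingHom ℝ), ← hP, hs.natDegree_eq_card_roots]; rfl
  -- For simple roots, `P'(a)` is the product of `a - b` over the other roots `b`, so the
  -- discriminant bound concerns differences of roots.
  have h2 : (P.roots.map fun a => |(derivative P).eval a|).prod
      = ∏ a ∈ S, ∏ b ∈ S.erase a, |a - b| := by
    show (S.val.map _).prod = _
    rw [Finset.prod_map_val]
    refine Finset.prod_congr rfl fun a ha => ?_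
    have hPS : P = ∏ b ∈ S, (X - C b) := by
      conv_lhs => rw [hs.eq_prod_roots_of_monic (hp.map _)]
      rfl
    rw [← Finset.abs_prod, hPS, derivative_prod_finset, eval_finsetSum]
    congr 1
    rw [Finset.sum_eq_single a]
    · simp [eval_prod]
    · intro b _ hba
      simp only [eval_mul, eval_prod]
      rw [Finset.prod_eq_zero (i := a)]
      · simp
      · exact Finset.mem_erase.2 ⟨hba.symm, ha⟩
      · simp
    · exact fun h => (h ha).elim
  rw [h2] at h1
  refine h1.trans ?_
  have hL : 1 ≤ 2 * K + 1 := by linarith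
  have hle : ∀ a ∈ S, ∀ b ∈ S, |a - b| ≤ 2 * K + 1 := fun a ha b hb => by
    have := abs_sub a b
    have := hroot a ha
    have := hroot b hb
    linarith
  -- Each root of the cluster `T` has `m - 1` neighbours at distance at most `2 * ε`. All other
  -- differences are at most `2 * K + 1`; as this is at least 1, its exponent may be padded to
  -- `S.card`.
  have h3 : ∀ a ∈ S, ∏ b ∈ S.erase a, |a - b| ≤
      (if a ∈ T then (2 * ε) ^ (m - 1) else 1) * (2 * K + 1) ^ S.card := by
    intro a ha
    have hc : (2 * K + 1) ^ (S.erase a).card ≤ (2 * K + 1) ^ S.card :=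
      pow_le_pow_right₀ hL (Finset.card_le_card (Finset.erase_subset _ _))
    split_ifs with haT
    · calc ∏ b ∈ S.erase a, |a - b|
          ≤ ∏ b ∈ S.erase a, ((if b ∈ T then 2 * ε else 1) * (2 * K + 1)) := by
            refine Finset.prod_le_prod (fun _ _ => abs_nonneg _) fun b hb => ?_
            split_ifs with hbT
            · have h4 := (Finset.mem_filter.1 haT).2
              have h5 := (Finset.mem_filter.1 hbT).2
              have : |a - b| ≤ 2 * ε := by
                rw [abs_lt] at h4 h5
                rw [abs_le]
                constructor <;> linarith
              nlinarith
            · rw [one_mul]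
              exact hle a ha b (Finset.mem_of_mem_erase hb)
        _ = (2 * ε) ^ (m - 1) * (2 * K + 1) ^ (S.erase a).card := by
            rw [Finset.prod_mul_distrib, Finset.prod_const, Finset.prod_ite, Finset.prod_const,
              Finset.prod_const_one, mul_one]
            congr 2
            rw [← hT, ← Finset.card_erase_of_mem haT]
            congr 1
            ext b
            simp only [Finset.mem_filter, Finset.mem_erase, T]
            tauto
        _ ≤ _ := by gcongr
    · rw [one_mul]
      refine (Finset.prod_le_prod (fun _ _ => abs_nonneg _) fun b hb =>
        hle a ha b (Finset.mem_of_mem_erase hb)).trans ?_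
      rwa [Finset.prod_const]
  refine (Finset.prod_le_prod (fun _ _ => Finset.prod_nonneg fun _ _ => abs_nonneg _) h3).trans
    (le_of_eq ?_)
  rw [Finset.prod_mul_distrib, Finset.prod_const, Finset.prod_ite, Finset.prod_const,
    Finset.prod_const_one, mul_one, ← pow_mul, ← pow_mul, hS]
  congr 2
  rw [mul_comm, ← hT]
  congr 2
  ext b
  simp only [Finset.mem_filter, T]
  tauto

/-- Near a transcendental number there are no roots of monic integer polynomials of bounded
degree with bounded real roots. -/
theorem exists_isolation {c : ℝ} (hc : Transcendental ℤ c) (K : ℝ) (d : ℕ) :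
    ∃ ε > 0, ∀ p : ℤ[X], p.Monic → (p.map (Int.castRingHom ℝ)).Splits → p.natDegree ≤ d →
      (∀ a ∈ (p.map (Int.castRingHom ℝ)).roots, |a| ≤ K) →
      ∀ a ∈ (p.map (Int.castRingHom ℝ)).roots, ε ≤ |a - c| := by
  classical
  -- Bounded roots and degree bound the integer coefficients by `N`. Hence only finitely many roots
  -- occur; `c` is none of them, and a finite set is closed.
  obtain ⟨N, hN⟩ := exists_nat_ge (max K 1 ^ d * (d.choose (d / 2) : ℝ))
  have hfin := bUnion_roots_finite (Int.castRingHom ℝ) d (Set.finite_Icc (-N : ℤ) N)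
  set U := (⋃ (f : ℤ[X]) (_ : f.natDegree ≤ d ∧ ∀ i, f.coeff i ∈ Set.Icc (-N : ℤ) N),
        ((f.map (Int.castRingHom ℝ)).roots.toFinset : Set ℝ)) with hU
  have hcU : c ∈ Uᶜ := by
    rw [Set.mem_compl_iff, hU]
    simp only [Set.mem_iUnion, not_exists]
    intro f _ h
    rw [Finset.mem_coe, Multiset.mem_toFinset, mem_roots'] at h
    refine hc ⟨f, fun h0 => h.1 (by simp [h0]), ?_⟩
    have := h.2
    rwa [IsRoot.def, eval_map] at this
  obtain ⟨ε, hε, h⟩ := Metric.isOpen_iff.1 hfin.isClosed.isOpen_compl c hcU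
  refine ⟨ε, hε, fun p hp hs hd hroot a ha => ?_⟩
  by_contra hlt
  refine h (Metric.mem_ball.2 (by rw [Real.dist_eq]; linarith) : a ∈ Metric.ball c ε) ?_
  rw [hU]
  simp only [Set.mem_iUnion]
  refine ⟨p, ⟨hd, fun i => ?_⟩, by simpa using mem_roots'.1 ha⟩
  have := (coeff_bdd_of_roots_le (Int.castRingHom ℝ) hp hs hd hroot i).trans hN
  rw [coeff_map, eq_intCast, Real.norm_eq_abs] at this
  rw [Set.mem_Icc, ← abs_le]
  exact_mod_cast this

/-- Both sides of the inequality are additive under multiplication of polynomials, so strong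
induction on the degree reduces to irreducible `p`. In degree at most `j` isolation leaves no root
near `c`; in larger degree the discriminant bound applies. -/
theorem exists_small_clusters {c : ℝ} (hc : Transcendental ℤ c) {K : ℝ} (hK : 0 ≤ K) (j : ℕ) :
    ∃ ε > 0, ∀ p : ℤ[X], p.Monic → (p.map (Int.castRingHom ℝ)).Splits →
      (∀ a ∈ (p.map (Int.castRingHom ℝ)).roots, |a| ≤ K) →
      j * ((p.map (Int.castRingHom ℝ)).roots.filter fun a => |a - c| < ε).card
        ≤ p.natDegree := by
  classical
  obtain ⟨ε₁, hε₁, h₁⟩ := exists_isolation hc K j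
  set L := 2 * K + 1 with hL
  have hL1 : 1 ≤ L := by linarith
  have hLp : 0 < L ^ (2 * j ^ 2) := by positivity
  -- Chosen so that `2 * ε₂ * L ^ (2 * j ^ 2)` equals `1 / 2`.
  set ε₂ := (2 * (2 * L ^ (2 * j ^ 2)))⁻¹ with hε₂
  have hε₂p : 0 < ε₂ := by positivity
  have hε₂1 : 2 * ε₂ * L ^ (2 * j ^ 2) < 1 := by
    rw [hε₂]; field_simp; norm_num
  have hε₂2 : 2 * ε₂ ≤ 1 := by
    have : 1 ≤ L ^ (2 * j ^ 2) := one_le_pow₀ hL1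
    nlinarith
  refine ⟨min ε₁ ε₂, lt_min hε₁ hε₂p, fun p => ?_⟩
  induction hn : p.natDegree using Nat.strong_induction_on generalizing p with
  | _ n ih =>
  intro hp hs hroot
  by_cases h1 : p = 1
  · subst h1; simp
  by_cases hirr : Irreducible p
  · rcases le_or_gt p.natDegree j with hd | hd
    · have : ((p.map (Int.castRingHom ℝ)).roots.filter fun a => |a - c| < min ε₁ ε₂) = 0 := by
        rw [Multiset.filter_eq_nil]
        intro a ha h
        exact absurd (h₁ p hp hs hd hroot a ha) (not_le.2 (h.trans_le (min_le_left _ _)))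
      rw [this]; simp
    · set m := ((p.map (Int.castRingHom ℝ)).roots.filter
        fun a => |a - c| < min ε₁ ε₂).card with hm
      rw [← hn]
      by_contra! hlt
      -- From `j < p.natDegree < j * m`. A single nearby root would give `m * (m - 1) = 0` and no
      -- contradiction.
      have hm2 : 2 ≤ m := by
        by_contra! h
        interval_cases m <;> omega
      have h2 := one_le_cluster_bound hp hirr hs hK (lt_min hε₁ hε₂p)
        (by linarith [min_le_right ε₁ ε₂]) hroot hm.symm
      -- The degree is below `j * m`, and `m ≤ 2 * (m - 1)`. Thus the large factor is absorbed by
      -- the power of `ε₂`.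
      have h3 : p.natDegree * p.natDegree ≤ 2 * j ^ 2 * (m * (m - 1)) := by
        obtain ⟨k, hk⟩ := Nat.exists_eq_add_of_le hm2
        rw [hk] at hlt ⊢
        have : 2 + k - 1 = k + 1 := by omega
        rw [this]
        calc p.natDegree * p.natDegree ≤ (j * (2 + k)) * (j * (2 + k)) :=
              Nat.mul_le_mul hlt.le hlt.le
          _ = j ^ 2 * ((2 + k) * (2 + k)) := by ring
          _ ≤ j ^ 2 * (2 * ((2 + k) * (k + 1))) := by
              refine Nat.mul_le_mul_left _ ?_
              nlinarith
          _ = _ := by ring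
      have h4 : (2 * min ε₁ ε₂) ^ (m * (m - 1)) * L ^ (p.natDegree * p.natDegree)
          ≤ (2 * ε₂ * L ^ (2 * j ^ 2)) ^ (m * (m - 1)) := by
        rw [mul_pow _ (L ^ _), ← pow_mul]
        have := min_le_right ε₁ ε₂
        gcongr
      have h5 : (2 * ε₂ * L ^ (2 * j ^ 2)) ^ (m * (m - 1)) < 1 :=
        pow_lt_one₀ (by positivity) hε₂1 (Nat.mul_ne_zero (by omega) (by omega))
      linarith
  · rw [hp.irreducible_iff_natDegree] at hirr
    push Not at hirr
    obtain ⟨f, g, hf, hg, hfg, hf0, hg0⟩ := hirr h1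
    have hdeg := hf.natDegree_mul hg
    rw [hfg, hn] at hdeg
    have hmap : p.map (Int.castRingHom ℝ) =
      f.map (Int.castRingHom ℝ) * g.map (Int.castRingHom ℝ) := by
      rw [← hfg, Polynomial.map_mul]
    have hne : f.map (Int.castRingHom ℝ) * g.map (Int.castRingHom ℝ) ≠ 0 :=
      ((hf.map _).mul (hg.map _)).ne_zero
    have hroots := roots_mul hne
    rw [hmap, hroots] at hroot ⊢
    rw [hmap] at hs
    have ihf := ih _ (by omega) f rfl hf (hs.of_dvd hne (dvd_mul_right _ _))
      fun a ha => hroot a (Multiset.mem_add.2 (Or.inl ha))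
    have ihg := ih _ (by omega) g rfl hg (hs.of_dvd hne (dvd_mul_left _ _))
      fun a ha => hroot a (Multiset.mem_add.2 (Or.inr ha))
    rw [Multiset.filter_add, Multiset.card_add, mul_add]
    omega

end AQ

/-! ### Eigenvalues of Hermitian matrices with rational entries; bump polynomials -/

namespace AQ
open Polynomial Matrix

theorem sum_norm_sq_eq_trace {n : Type*} [Fintype n] (M : Matrix n n ℂ) :
    ((∑ x, ∑ z, ‖M z x‖ ^ 2 : ℝ) : ℂ) = (star M * M).trace := by
  simp only [Matrix.trace, diag_apply, Matrix.mul_apply, Matrix.star_apply]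
  push_cast
  refine Finset.sum_congr rfl fun x _ => Finset.sum_congr rfl fun z _ => ?_
  rw [RCLike.star_def, Complex.conj_mul']

section hermitian

variable {n : Type*} [Fintype n] [DecidableEq n]

theorem aeval_diagonal (d : n → ℂ) (p : ℂ[X]) :
    aeval (diagonal d) p = diagonal fun i => p.eval (d i) := by
  have h : diagonal d = diagonalAlgHom ℂ d := rfl
  rw [h, aeval_algHom_apply, aeval_pi]
  rfl

/-- The Hilbert-Schmidt norm of a polynomial of a Hermitian matrix. -/
theorem sum_norm_sq_aeval {A : Matrix n n ℂ} (hA : A.IsHermitian) (p : ℂ[X]) :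
    ∑ x, ∑ z, ‖(aeval A p) z x‖ ^ 2 = ∑ i, ‖p.eval (hA.eigenvalues i : ℂ)‖ ^ 2 := by
  have h : aeval A p = Unitary.conjStarAlgAut ℂ _ hA.eigenvectorUnitary
      (diagonal fun i => p.eval (hA.eigenvalues i : ℂ)) := by
    conv_lhs => rw [hA.spectral_theorem, aeval_algHom_apply, aeval_diagonal]
    rfl
  rw [← Complex.ofReal_inj, sum_norm_sq_eq_trace, h, ← map_star, ← map_mul,
    Unitary.conjStarAlgAut_apply, trace_mul_cycle, Unitary.coe_star_mul_self, one_mul,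
    ← sum_norm_sq_eq_trace, Complex.ofReal_inj]
  refine Finset.sum_congr rfl fun i _ => ?_
  rw [Finset.sum_eq_single i]
  · simp
  · intro j _ hj; simp [diagonal_apply_ne _ hj]
  · simp

theorem charpoly_smul_eq {A : Matrix n n ℂ} (hA : A.IsHermitian) (D : ℂ) :
    (D • A).charpoly = ∏ i, (X - C (D * (hA.eigenvalues i : ℂ))) := by
  conv_lhs => rw [hA.spectral_theorem, ← map_smul, Unitary.conjStarAlgAut_apply,
    charpoly_mul_comm, ← mul_assoc, Unitary.coe_star_mul_self, one_mul, ← diagonal_smul,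
    charpoly_diagonal]
  rfl

/-- Gershgorin: an eigenvalue differs from some diagonal entry by at most the rest of the absolute
row sum. -/
theorem abs_eigenvalues_le {A : Matrix n n ℂ} (hA : A.IsHermitian) {K : ℝ}
    (hK : ∀ x, ∑ y, ‖A x y‖ ≤ K) (i : n) : |hA.eigenvalues i| ≤ K := by
  have h : Module.End.HasEigenvalue (toLin' A) (hA.eigenvalues i : ℂ) := by
    refine Module.End.hasEigenvalue_of_hasEigenvector
      (x := (hA.eigenvectorBasis i).ofLp) ⟨?_, ?_⟩
    · rw [Module.End.mem_eigenspace_iff, toLin'_apply, hA.mulVec_eigenvectorBasis]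
      rfl
    · intro h0
      have h1 := hA.eigenvectorBasis.orthonormal.1 i
      have h2 : hA.eigenvectorBasis i = 0 := by
        ext x; exact congrFun h0 x
      rw [h2, norm_zero] at h1
      exact zero_ne_one h1
  obtain ⟨k, hk⟩ := eigenvalue_mem_ball h
  rw [Metric.mem_closedBall, dist_eq_norm] at hk
  have h1 := Finset.add_sum_erase Finset.univ (fun y => ‖A k y‖) (Finset.mem_univ k)
  have h2 : ‖(hA.eigenvalues i : ℂ)‖ ≤ ‖A k k‖ + ‖(hA.eigenvalues i : ℂ) - A k k‖ := by
    have := norm_add_le (A k k) ((hA.eigenvalues i : ℂ) - A k k)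
    rwa [add_sub_cancel] at this
  rw [Complex.norm_real, Real.norm_eq_abs] at h2
  linarith [hK k]

end hermitian

/-- The eigenvalues of Hermitian matrices of bounded row sums with rational entries of a fixed
denominator do not concentrate near a transcendental number. -/
theorem exists_eigenvalue_spread {c : ℝ} (hc : Transcendental ℚ c) {K : ℝ} (hK : 0 ≤ K)
    {D : ℕ} (hD : 0 < D) (j : ℕ) :
    ∃ ε > 0, ∀ {n : Type*} [Fintype n] [DecidableEq n] {A : Matrix n n ℂ} (hA : A.IsHermitian),
      (∀ x y, ∃ z : ℤ, (D : ℂ) * A x y = z) → (∀ x, ∑ y, ‖A x y‖ ≤ K) →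
      j * (Finset.univ.filter fun i => |hA.eigenvalues i - c| < ε).card ≤ Fintype.card n := by
  have hD' : (0 : ℝ) < D := by exact_mod_cast hD
  -- Clearing denominators multiplies the eigenvalues, and hence the point `c`, by `D`; this is also
  -- why the final radius is `ε / D`.
  have hDc : Transcendental ℤ ((D : ℝ) * c) := by
    rw [Transcendental, IsFractionRing.isAlgebraic_iff ℤ ℚ ℝ]
    intro h
    refine hc ?_
    have h2 : IsAlgebraic ℚ ((D : ℝ)⁻¹) := (isAlgebraic_natCast D).inv
    have := h2.mul h
    rwa [inv_mul_cancel_left₀ hD'.ne'] at this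
  obtain ⟨ε, hε, h⟩ := exists_small_clusters hDc (K := D * K) (by positivity) j
  refine ⟨ε / D, by positivity, fun {n} _ _ A hA hint hrow => ?_⟩
  choose Z hZ using hint
  set p : ℤ[X] := (Matrix.of Z).charpoly with hp
  -- The integer characteristic polynomial is identified after embedding in `ℂ`, where the spectral
  -- theorem applies; this shows that it splits over `ℝ`.
  have hprod : p.map (Int.castRingHom ℝ) = ∏ i, (X - C ((D : ℝ) * hA.eigenvalues i)) := by
    apply Polynomial.map_injective _ (algebraMap ℝ ℂ).injective
    rw [Polynomial.map_map, Polynomial.map_prod, hp, ← charpoly_map]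
    have h1 : (Matrix.of Z).map ((algebraMap ℝ ℂ).comp (Int.castRingHom ℝ)) = (D : ℂ) • A := by
      ext x y
      simp [hZ]
    rw [h1, charpoly_smul_eq hA]
    simp
  have hroots : (p.map (Int.castRingHom ℝ)).roots =
      Finset.univ.val.map fun i => (D : ℝ) * hA.eigenvalues i := by
    rw [hprod]
    exact roots_multiset_prod_X_sub_C (Finset.univ.val.map fun i => (D : ℝ) * hA.eigenvalues i) ▸
      by rw [Multiset.map_map]; rfl
  have hs : (p.map (Int.castRingHom ℝ)).Splits := by
    rw [hprod]
    exact Splits.prod fun i _ => Splits.X_sub_C _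
  have := h p (charpoly_monic _) hs (by
    rw [hroots]
    intro a ha
    obtain ⟨i, -, rfl⟩ := Multiset.mem_map.1 ha
    rw [abs_mul, abs_of_pos hD']
    exact mul_le_mul_of_nonneg_left (abs_eigenvalues_le hA hrow i) hD'.le)
  rw [hroots, hp, charpoly_natDegree_eq_dim, Multiset.filter_map, Multiset.card_map] at this
  convert this using 2
  rw [Finset.card_def, Finset.filter_val]
  congr 1
  refine Multiset.filter_congr fun i _ => ?_
  simp only [Function.comp]
  rw [← mul_sub, abs_mul, abs_of_pos hD', lt_div_iff₀ hD', mul_comm]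

/-- The polynomial `(1 - (X - c)² / M) ^ k`. -/
noncomputable def bump (c M : ℝ) (k : ℕ) : ℂ[X] :=
  (1 - C ((M : ℂ)⁻¹) * (X - C (c : ℂ)) ^ 2) ^ k

/-- The base `1 - (t - c)² / M` lies in `[0, 1]`, and away from `c` it is at most `1 - ε² / M`, so
its powers decay geometrically. The maximum with 0 keeps the bound a nonnegative number when `ε² >
M`. -/
theorem norm_bump_eval_sq_le {c M t : ℝ} (k : ℕ) (hM : 0 < M) (ht : (t - c) ^ 2 ≤ M) {ε : ℝ}
    (hε : 0 < ε) : ‖(bump c M k).eval (t : ℂ)‖ ^ 2 ≤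
      (if |t - c| < ε then 1 else 0) + max (1 - ε ^ 2 / M) 0 ^ k := by
  have h1 : (bump c M k).eval (t : ℂ) = (((1 - (t - c) ^ 2 / M) ^ k : ℝ) : ℂ) := by
    simp [bump]
    ring
  have h2 : (t - c) ^ 2 / M ≤ 1 := (div_le_one hM).2 ht
  have h3 : 0 ≤ (t - c) ^ 2 / M := by positivity
  set b := 1 - (t - c) ^ 2 / M with hb
  have hb0 : 0 ≤ b := by linarith
  have hb1 : b ^ k ≤ 1 := pow_le_one₀ hb0 (by linarith)
  rw [h1, Complex.norm_real, Real.norm_eq_abs, sq_abs]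
  have h4 : (b ^ k) ^ 2 ≤ b ^ k := by nlinarith [pow_nonneg hb0 k]
  split_ifs with h
  · have : 0 ≤ max (1 - ε ^ 2 / M) 0 ^ k := by positivity
    linarith
  · rw [zero_add]
    refine h4.trans (pow_le_pow_left₀ hb0 (le_max_of_le_left ?_) k)
    have : ε ^ 2 ≤ (t - c) ^ 2 := by
      rw [← sq_abs (t - c)]
      exact pow_le_pow_left₀ hε.le (not_lt.1 h) 2
    rw [hb]
    gcongr

theorem sum_norm_sq_bump_le {n : Type*} [Fintype n] [DecidableEq n] {A : Matrix n n ℂ}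
    (hA : A.IsHermitian) {c M : ℝ} (k : ℕ) (hM : 0 < M)
    (hAM : ∀ i, (hA.eigenvalues i - c) ^ 2 ≤ M) {ε : ℝ} (hε : 0 < ε) :
    ∑ x, ∑ z, ‖(aeval A (bump c M k)) z x‖ ^ 2 ≤
      (Finset.univ.filter fun i => |hA.eigenvalues i - c| < ε).card
        + Fintype.card n * max (1 - ε ^ 2 / M) 0 ^ k := by
  rw [sum_norm_sq_aeval hA]
  refine (Finset.sum_le_sum fun i _ => norm_bump_eval_sq_le k hM (hAM i) hε).trans (le_of_eq ?_)
  rw [Finset.sum_add_distrib, Finset.sum_const, Finset.card_univ, nsmul_eq_mul,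
    Finset.sum_boole]

end AQ

/-! ### Jumps of the spectral distribution of a self-adjoint operator -/

namespace AQ
open Polynomial

section spectralJump

variable {H : Type*} [NormedAddCommGroup H] [InnerProductSpace ℂ H] [CompleteSpace H]

/-- Commuting with `S` makes `ker F` invariant under `S`; commuting with the adjoint does the same
for the orthogonal complement. -/
theorem starProjection_ker_commute {F S : H →L[ℂ] H} (h : Commute F S) (h' : Commute F (star S))
    (v : H) : F.ker.starProjection (S v) = S (F.ker.starProjection v) := by
  have hinv : ∀ R : H →L[ℂ] H, Commute F R → ∀ w ∈ F.ker, R w ∈ F.ker := by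
    intro R hR w hw
    have h1 : F w = 0 := hw
    have h2 := congrArg (fun L : H →L[ℂ] H => L w) hR.eq
    simp only [mul_apply_eq_comp, h1, map_zero] at h2
    exact h2
  refine Submodule.eq_starProjection_of_mem_orthogonal
    (hinv S h _ (Submodule.starProjection_apply_mem _ v)) ?_
  rw [← map_sub, Submodule.mem_orthogonal]
  intro w hw
  rw [← ContinuousLinearMap.adjoint_inner_left]
  exact (Submodule.mem_orthogonal _ _).1 (Submodule.sub_starProjection_mem_orthogonal v) _
    (hinv _ h' w hw)

theorem spectralProjection_aeval {T : H →L[ℂ] H} (hT : IsSelfAdjoint T) (c : ℝ) (p : ℂ[X])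
    (v : H) : spectralProjection T c (aeval T p v) = aeval T p (spectralProjection T c v) := by
  have h1 : Commute T (aeval T p) := by
    have := (Commute.all X p).map (aeval T)
    rwa [aeval_X] at this
  have h2 : Commute T (star (aeval T p)) := by
    have := h1.star_star
    rwa [hT.star_eq] at this
  exact starProjection_ker_commute (h1.cfc_real _) (h2.cfc_real _) v

theorem ker_posPart_mono {T : H →L[ℂ] H} {s t : ℝ} (hst : s < t) :
    (cfc (fun x : ℝ => max (x - s) 0) T).ker ≤ (cfc (fun x : ℝ => max (x - t) 0) T).ker := by
  intro v hv
  have hv' : cfc (fun x : ℝ => max (x - s) 0) T v = 0 := hv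
  show cfc (fun x : ℝ => max (x - t) 0) T v = 0
  have hpos : ∀ x : ℝ, 0 < max (x - s) (t - s) := fun x => lt_max_of_lt_right (by linarith)
  -- `(x - t)⁺` is a continuous multiple of `(x - s)⁺`; replacing the denominator by `max (x - s) (t
  -- - s)` keeps it positive.
  have h : cfc (fun x : ℝ => max (x - t) 0) T =
      cfc (fun x : ℝ => max (x - t) 0 / max (x - s) (t - s)) T
        * cfc (fun x : ℝ => max (x - s) 0) T := by
    rw [← cfc_mul _ _ T (Continuous.continuousOn <| by
        refine Continuous.div (by fun_prop) (by fun_prop) fun x => (hpos x).ne')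
      (by fun_prop)]
    congr 1
    ext x
    rcases le_or_gt x t with h | h
    · rw [max_eq_right (by linarith : x - t ≤ 0)]; simp
    · rw [max_eq_left (by linarith : 0 ≤ x - s), max_eq_left (by linarith : t - s ≤ x - s),
        div_mul_cancel₀ _ (by linarith)]
  rw [h, mul_apply_eq_comp, hv', map_zero]

/-- Such `v` lies in the spectral subspace of `(s, t]`. On it `T` agrees with its truncation to `[s,
t]`, which differs from `c` by at most `t - s`. -/
theorem norm_sub_le_of_spectral_window {T : H →L[ℂ] H} (hT : IsSelfAdjoint T) {s c t : ℝ}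
    (hs : s < c) (ht : c < t) {v : H} (hvt : v ∈ (cfc (fun x : ℝ => max (x - t) 0) T).ker)
    (hvs : v ∈ (cfc (fun x : ℝ => max (x - s) 0) T).kerᗮ) :
    ‖T v - (c : ℂ) • v‖ ≤ (t - s) * ‖v‖ := by
  set F := cfc (fun x : ℝ => max (x - s) 0) T with hF
  set N := cfc (fun x : ℝ => max (s - x) 0) T with hN
  have hFN : F * N = 0 := by
    rw [hF, hN, ← cfc_mul _ _ T (by fun_prop) (by fun_prop)]
    have : (fun x : ℝ => max (x - s) 0 * max (s - x) 0) = fun _ => 0 := by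
      ext x
      rcases le_total x s with h | h
      · rw [max_eq_right (by linarith : x - s ≤ 0), zero_mul]
      · rw [max_eq_right (by linarith : s - x ≤ 0), mul_zero]
    rw [this, cfc_const_zero]
  -- The range of `N` lies in `ker F`, to which `v` is orthogonal, so `‖N v‖² = ⟪N (N v), v⟫ = 0`.
  have hNv : N v = 0 := by
    have h1 : N v ∈ F.ker := by
      have := congrArg (fun L : H →L[ℂ] H => L v) hFN
      exact this
    have hNs : IsSelfAdjoint N := cfc_predicate _ _
    have hNF : N * F = 0 := by
      rw [← (cfc_commute_cfc (fun x : ℝ => max (x - s) 0) (fun x : ℝ => max (s - x) 0) T).eq]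
      exact hFN
    have h2 : N (N v) ∈ F.ker := by
      have := congrArg (fun L : H →L[ℂ] H => L (N v)) hFN
      exact this
    have h3 := (Submodule.mem_orthogonal _ _).1 hvs _ h2
    have h4 : ⟪N (N v), v⟫_ℂ = ⟪N v, N v⟫_ℂ := by
      rw [← ContinuousLinearMap.adjoint_inner_right]
      congr 1
      exact congrArg (fun L : H →L[ℂ] H => L v) hNs.star_eq
    rw [h4] at h3
    exact inner_self_eq_zero.1 h3
  have hTeq : T - algebraMap ℝ (H →L[ℂ] H) c =
      cfc (fun x : ℝ => max s (min x t) - c) T + cfc (fun x : ℝ => max (x - t) 0) T - N := by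
    rw [hN, ← cfc_add T _ _ (by fun_prop) (by fun_prop),
      ← cfc_sub _ _ T (by fun_prop) (by fun_prop)]
    conv_lhs => rw [← cfc_id' ℝ T, ← cfc_const c T, ← cfc_sub _ _ T (by fun_prop) (by fun_prop)]
    congr 1
    ext x
    rcases le_total x s with h1 | h1
    · rw [min_eq_left (by linarith), max_eq_left (by linarith), max_eq_right (by linarith),
        max_eq_left (by linarith)]
      ring
    · rcases le_total x t with h2 | h2
      · rw [min_eq_left (by linarith), max_eq_right (by linarith), max_eq_right (by linarith),
          max_eq_right (by linarith)]
        ring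
      · rw [min_eq_right (by linarith), max_eq_right (by linarith), max_eq_left (by linarith),
          max_eq_right (by linarith)]
        ring
  have h5 : T v - (c : ℂ) • v = cfc (fun x : ℝ => max s (min x t) - c) T v := by
    have h6 := congrArg (fun L : H →L[ℂ] H => L v) hTeq
    have h7 : cfc (fun x : ℝ => max (x - t) 0) T v = 0 := hvt
    simp only [_root_.sub_apply, _root_.add_apply, h7, hNv, add_zero,
      sub_zero] at h6
    rw [← h6, Algebra.algebraMap_eq_smul_one, _root_.smul_apply]
    rfl
  rw [h5]
  refine (ContinuousLinearMap.le_opNorm _ _).trans (mul_le_mul_of_nonneg_right ?_ (norm_nonneg v))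
  refine norm_cfc_le (by linarith) fun x _ => ?_
  rw [Real.norm_eq_abs, abs_le]
  have h8 : s ≤ max s (min x t) := le_max_left _ _
  have h9 : max s (min x t) ≤ t := max_le (by linarith) (min_le_right _ _)
  constructor <;> linarith

theorem exists_root_factor (p : ℂ[X]) (c : ℂ) :
    ∃ r : ℂ[X], p = C (p.eval c) + r * (X - C c) := by
  refine ⟨p /ₘ (X - C c), ?_⟩
  conv_lhs => rw [← modByMonic_add_div p (X - C c), modByMonic_X_sub_C_eq_C_eval, mul_comm]

/-- A jump of the spectral distribution function bounds from below the norms of polynomials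
normalized at the jump. -/
theorem exists_le_norm_sq_of_not_continuousAt {T : H →L[ℂ] H} (hT : IsSelfAdjoint T) (v₀ : H)
    {c : ℝ} (hc : ¬ ContinuousAt (fun t => ‖spectralProjection T t v₀‖ ^ 2) c) :
    ∃ δ > 0, ∀ p : ℂ[X], p.eval (c : ℂ) = 1 → δ ≤ ‖aeval T p v₀‖ ^ 2 := by
  set K : ℝ → Submodule ℂ H := fun t => (cfc (fun x : ℝ => max (x - t) 0) T).ker with hKdef
  have hE : ∀ t v, spectralProjection T t v ∈ K t := fun t v =>
    Submodule.starProjection_apply_mem _ v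
  -- The difference is `(v - E_s v) - (v - E_t v)`, and both terms are orthogonal to `K s`.
  have hperp : ∀ s t v, s < t →
      spectralProjection T t v - spectralProjection T s v ∈ (K s)ᗮ := by
    intro s t v hst
    have h1 : v - spectralProjection T s v ∈ (K s)ᗮ :=
      Submodule.sub_starProjection_mem_orthogonal v
    have h2 : v - spectralProjection T t v ∈ (K s)ᗮ :=
      Submodule.orthogonal_le (ker_posPart_mono hst)
        (Submodule.sub_starProjection_mem_orthogonal v)
    have := Submodule.sub_mem _ h1 h2
    rwa [sub_sub_sub_cancel_left] at this
  have hpyth : ∀ s t v, s < t → ‖spectralProjection T t v‖ ^ 2 =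
      ‖spectralProjection T t v - spectralProjection T s v‖ ^ 2
        + ‖spectralProjection T s v‖ ^ 2 := by
    intro s t v hst
    have h := (Submodule.mem_orthogonal' _ _).1 (hperp s t v hst) _ (hE s v)
    have := norm_add_sq_eq_norm_sq_add_norm_sq_of_inner_eq_zero _ _ h
    rw [sub_add_cancel] at this
    simpa only [sq] using this
  have hmono : Monotone fun t => ‖spectralProjection T t v₀‖ ^ 2 := by
    intro s t hst
    rcases hst.eq_or_lt with rfl | h
    · exact le_rfl
    · simp only
      rw [hpyth s t v₀ h]
      have := sq_nonneg ‖spectralProjection T t v₀ - spectralProjection T s v₀‖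
      linarith
  -- A monotone function that is discontinuous at `c` has a gap of fixed size across every interval
  -- around `c`.
  have hjump : ∃ δ > 0, ∀ s t, s < c → c < t → δ ≤
      ‖spectralProjection T t v₀‖ ^ 2 - ‖spectralProjection T s v₀‖ ^ 2 := by
    by_contra! hcon
    refine hc (Metric.continuousAt_iff'.2 fun ε hε => ?_)
    obtain ⟨s, t, hs, ht, h⟩ := hcon ε hε
    filter_upwards [Ioo_mem_nhds hs ht] with u hu
    have h1 := hmono hu.1.le
    have h2 := hmono hu.2.le
    have h3 := hmono hs.le
    have h4 := hmono ht.le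
    simp only at h1 h2 h3 h4
    rw [Real.dist_eq, abs_lt]
    constructor <;> linarith
  obtain ⟨δ, hδ, hjump⟩ := hjump
  refine ⟨δ / 4, by positivity, fun p hp => ?_⟩
  obtain ⟨r, hr⟩ := exists_root_factor p c
  rw [hp, C_1] at hr
  set R := ‖aeval T r‖ with hR
  have hR0 : 0 ≤ R := norm_nonneg _
  -- The window may depend on `p`, since `δ` does not depend on the window. With `2 * h * R ≤ 1 /
  -- 2`, the term `r(T)(T - c)v` has norm at most `‖v‖ / 2`, so `p(T)v` keeps at least half of the
  -- norm of `v`.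
  set h := 1 / (4 * (R + 1)) with hh
  have hpos : 0 < h := by positivity
  set v := spectralProjection T (c + h) v₀ - spectralProjection T (c - h) v₀ with hv
  have hvt : v ∈ K (c + h) :=
    Submodule.sub_mem _ (hE _ _) (ker_posPart_mono (by linarith) (hE _ _))
  have hvs : v ∈ (K (c - h))ᗮ := hperp _ _ _ (by linarith)
  have h1 := norm_sub_le_of_spectral_window hT (by linarith : c - h < c) (by linarith) hvt hvs
  have h2 : δ ≤ ‖v‖ ^ 2 := by
    have := hjump (c - h) (c + h) (by linarith) (by linarith)
    rw [hpyth (c - h) (c + h) v₀ (by linarith)] at this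
    linarith
  have h3 : aeval T p v = v + aeval T r (T v - (c : ℂ) • v) := by
    conv_lhs => rw [hr]
    simp only [map_add, map_one, map_mul, map_sub, aeval_X, aeval_C,
      _root_.add_apply, mul_apply_eq_comp, _root_.sub_apply,
      Algebra.algebraMap_eq_smul_one, _root_.smul_apply]
    rfl
  have h4 : ‖aeval T r (T v - (c : ℂ) • v)‖ ≤ ‖v‖ / 2 := by
    calc _ ≤ R * ‖T v - (c : ℂ) • v‖ := ContinuousLinearMap.le_opNorm _ _
      _ ≤ R * ((c + h - (c - h)) * ‖v‖) := by gcongr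
      _ = R * (2 * h) * ‖v‖ := by ring
      _ ≤ 1 / 2 * ‖v‖ := by
          gcongr
          rw [hh]
          field_simp
          linarith
      _ = _ := by ring
  have h5 : ‖v‖ / 2 ≤ ‖aeval T p v‖ := by
    have := norm_sub_norm_le v (-(aeval T r (T v - (c : ℂ) • v)))
    rw [sub_neg_eq_add, norm_neg, ← h3] at this
    linarith
  -- `p(T)v` is the spectral projection of `p(T)v₀` to the window.
  have h6 : ‖aeval T p v‖ ≤ ‖aeval T p v₀‖ := by
    rw [hv, map_sub, ← spectralProjection_aeval hT, ← spectralProjection_aeval hT]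
    set w := aeval T p v₀
    have ha := hpyth (c - h) (c + h) w (by linarith)
    have hb : ‖spectralProjection T (c + h) w‖ ≤ ‖w‖ := Submodule.norm_starProjection_apply_le _ w
    have hc := sq_nonneg ‖spectralProjection T (c - h) w‖
    have hd : ‖spectralProjection T (c + h) w‖ ^ 2 ≤ ‖w‖ ^ 2 := by gcongr
    exact le_of_sq_le_sq (by linarith) (norm_nonneg _)
  have h7 : (‖v‖ / 2) ^ 2 ≤ ‖aeval T p v₀‖ ^ 2 := by
    gcongr
    exact h5.trans h6
  linarith [h7, (by ring : (‖v‖ / 2) ^ 2 = ‖v‖ ^ 2 / 4)]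

end spectralJump

end AQ

/-! ### Polynomials of `B` in the pattern algebra, on the GNS space and on functions -/

namespace AQ
open Polynomial

section algebraFacts

variable {V : Type*} {G : SimpleGraph V} [IsAQGraph G]

theorem mul_assoc' (A B C : PatternAlgebra G) : A * B * C = A * (B * C) := by
  classical
  ext x y
  set s := (row_finite A x).toFinset
  set t := (col_finite C y).toFinset
  have hs : ∀ f : V → ℂ, ∑ᶠ z, A x z * f z = ∑ z ∈ s, A x z * f z := fun f =>
    finsum_eq_sum_of_support_subset _ fun z hz => by
      simpa [s] using left_ne_zero_of_mul hz
  have ht : ∀ f : V → ℂ, ∑ᶠ z, f z * C z y = ∑ z ∈ t, f z * C z y := fun f =>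
    finsum_eq_sum_of_support_subset _ fun z hz => by
      simpa [t] using right_ne_zero_of_mul hz
  rw [mul_apply, mul_apply, ht, hs]
  simp only [mul_apply]
  simp only [hs, ht, Finset.sum_mul, Finset.mul_sum, mul_assoc]
  rw [Finset.sum_comm]

theorem star_mul' (A B : PatternAlgebra G) : star (A * B) = star B * star A := by
  ext x y
  rw [star_apply, mul_apply, mul_apply,
    map_finsum (starRingEnd ℂ) (row_mul_finite A y fun z => B z x)]
  refine finsum_congr fun z => ?_
  rw [map_mul, star_apply, star_apply, mul_comm]

/-- Testing the symmetry of the operator on point masses recovers the matrix entries. -/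
theorem star_eq_self_of_isPositive {B : PatternAlgebra G} (h : (l2Op B).IsPositive) :
    star B = B := by
  classical
  ext y x
  have hT : ∀ x y, l2Op B (lp.single 2 x (1 : ℂ)) y = B y x := by
    intro x y
    rw [l2Op_apply, finsum_eq_single _ x]
    · simp
    · intro z hz
      simp [hz]
  have h1 := h.1 (lp.single 2 y (1 : ℂ)) (lp.single 2 x (1 : ℂ))
  simp only [ContinuousLinearMap.coe_coe] at h1
  rw [lp.inner_single_left, lp.inner_single_right, hT, hT] at h1
  simpa [star_apply] using h1

theorem gnsRep_isSelfAdjoint {B : PatternAlgebra G} (hB : star B = B) :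
    IsSelfAdjoint (gnsRep B) := by
  rw [ContinuousLinearMap.isSelfAdjoint_iff_isSymmetric]
  intro a b
  simp only [ContinuousLinearMap.coe_coe]
  induction a using UniformSpace.Completion.induction_on with
  | hp => exact isClosed_eq (by fun_prop) (by fun_prop)
  | ih a =>
    induction b using UniformSpace.Completion.induction_on with
    | hp => exact isClosed_eq (by fun_prop) (by fun_prop)
    | ih b =>
      rw [gnsRep_coe, gnsRep_coe, UniformSpace.Completion.inner_coe,
        UniformSpace.Completion.inner_coe, inner_def, inner_def, star_mul', hB, mul_assoc']

/-- A projection is self-adjoint and idempotent; this puts the density of states in the form to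
which the jump estimate applies. -/
theorem ids_eq (B : PatternAlgebra G) (t : ℝ) :
    ids B t = ‖spectralProjection (gnsRep B) t ((1 : PatternAlgebra G) : GNS G)‖ ^ 2 := by
  show (⟪((1 : PatternAlgebra G) : GNS G),
    spectralProjection (gnsRep B) t ((1 : PatternAlgebra G) : GNS G)⟫_ℂ).re = _
  set v : GNS G := ((1 : PatternAlgebra G) : GNS G)
  unfold spectralProjection
  set K := (cfc (fun x : ℝ => max (x - t) 0) (gnsRep B)).ker
  have h : K.starProjection v = K.starProjection (K.starProjection v) :=
    (Submodule.starProjection_eq_self_iff.2 (Submodule.starProjection_apply_mem K v)).symm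
  rw [h, ← Submodule.inner_starProjection_left_eq_right, ← h]
  exact (inner_self_eq_norm_sq (𝕜 := ℂ) _)

/-- The action of a pattern-invariant matrix on all functions. -/
noncomputable def funOp (A : PatternAlgebra G) : (V → ℂ) →ₗ[ℂ] (V → ℂ) where
  toFun f x := ∑ᶠ y, A x y * f y
  map_add' f g := by
    ext x
    simp only [Pi.add_apply, mul_add]
    exact finsum_add_distrib (row_mul_finite A x _) (row_mul_finite A x _)
  map_smul' c f := by
    ext x
    simp only [Pi.smul_apply, smul_eq_mul, mul_left_comm _ c, RingHom.id_apply]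
    exact (smul_finsum c fun z => A x z * f z).symm

theorem funOp_apply (A : PatternAlgebra G) (f : V → ℂ) (x : V) :
    funOp A f x = ∑ᶠ y, A x y * f y := rfl

/-- The column of a pattern-invariant matrix at a vertex. -/
noncomputable def column (x : V) : PatternAlgebra G →ₗ[ℂ] (V → ℂ) where
  toFun A z := A z x
  map_add' _ _ := rfl
  map_smul' _ _ := rfl

/-- Transports `p(B)` between left multiplication on `P_G`, the GNS operator and the action on
functions. -/
theorem aeval_intertwine {M N : Type*} [AddCommGroup M] [AddCommGroup N] [Module ℂ M]
    [Module ℂ N] (f : M →ₗ[ℂ] N) (a : Module.End ℂ M) (b : Module.End ℂ N)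
    (h : ∀ m, f (a m) = b (f m)) (p : ℂ[X]) (m : M) : f (aeval a p m) = aeval b p (f m) := by
  induction p using Polynomial.induction_on generalizing m with
  | C z => simp [Algebra.algebraMap_eq_smul_one]
  | add p q hp hq => simp [hp, hq]
  | monomial n z ih =>
    have h1 : C z * X ^ (n + 1) = (C z * X ^ n) * X := by rw [pow_succ, mul_assoc]
    rw [h1, map_mul, map_mul (aeval b), aeval_X, aeval_X, Module.End.mul_apply,
      Module.End.mul_apply, ih, h]

theorem aeval_toLinearMap {M : Type*} [SeminormedAddCommGroup M] [NormedSpace ℂ M]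
    (T : M →L[ℂ] M) (p : ℂ[X]) (v : M) :
    aeval (T : Module.End ℂ M) p v = aeval T p v := by
  induction p using Polynomial.induction_on generalizing v with
  | C z => simp [Algebra.algebraMap_eq_smul_one]
  | add p q hp hq => simp [hp, hq]
  | monomial n z ih =>
    have h1 : C z * X ^ (n + 1) = (C z * X ^ n) * X := by rw [pow_succ, mul_assoc]
    rw [h1, map_mul, map_mul (aeval T), aeval_X, aeval_X, Module.End.mul_apply, ih]
    rfl

/-- The polynomial `p(B)` in the algebra of pattern-invariant matrices. -/
noncomputable def polyEval (B : PatternAlgebra G) (p : ℂ[X]) : PatternAlgebra G :=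
  aeval (leftMul B : Module.End ℂ (PatternAlgebra G)) p 1

theorem polyEval_coe (B : PatternAlgebra G) (p : ℂ[X]) :
    (polyEval B p : GNS G) = aeval (gnsRep B) p ((1 : PatternAlgebra G) : GNS G) := by
  rw [← aeval_toLinearMap]
  exact aeval_intertwine
    (UniformSpace.Completion.toComplL (𝕜 := ℂ) (E := PatternAlgebra G)).toLinearMap
    (leftMul B : Module.End ℂ (PatternAlgebra G)) (gnsRep B : Module.End ℂ (GNS G))
    (fun m => (gnsRep_coe B m).symm) p 1

theorem norm_sq_aeval_gnsRep (B : PatternAlgebra G) (p : ℂ[X]) :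
    ‖aeval (gnsRep B) p ((1 : PatternAlgebra G) : GNS G)‖ ^ 2
      = (trace (star (polyEval B p) * polyEval B p)).re := by
  rw [← polyEval_coe, UniformSpace.Completion.norm_coe, norm_def,
    Real.sq_sqrt (re_trace_star_mul_self_nonneg _)]

theorem polyEval_column [DecidableEq V] (B : PatternAlgebra G) (p : ℂ[X]) (x : V) :
    (fun z => polyEval B p z x) = aeval (funOp B) p (Pi.single x 1) := by
  have h1 : column x (1 : PatternAlgebra G) = Pi.single x 1 := by
    ext z
    show matOne z x = _
    simp only [matOne, Pi.single_apply]
    congr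
  rw [← h1]
  exact aeval_intertwine (column x) (leftMul B : Module.End ℂ (PatternAlgebra G)) (funOp B)
    (fun m => rfl) p 1

end algebraFacts

end AQ

/-! ### Compressions to finite vertex sets -/

namespace AQ
open Polynomial

section compression

variable {V : Type*} {G : SimpleGraph V} [IsAQGraph G]

/-- The compression of a matrix to a finite set of vertices. -/
def compression (B : PatternAlgebra G) (Q : Finset V) : Matrix Q Q ℂ :=
  Matrix.of fun x y => B x y

open Classical in
/-- Extension by zero of a function on a finite set of vertices. -/
noncomputable def extendZero (Q : Finset V) : (Q → ℂ) →ₗ[ℂ] (V → ℂ) where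
  toFun f z := if h : z ∈ Q then f ⟨z, h⟩ else 0
  map_add' f g := by
    ext z
    by_cases h : z ∈ Q <;> simp [h]
  map_smul' c f := by
    ext z
    by_cases h : z ∈ Q <;> simp [h]

theorem extendZero_mem {Q : Finset V} (f : Q → ℂ) (z : Q) : extendZero Q f z = f z := by
  simp [extendZero]

theorem extendZero_notMem {Q : Finset V} (f : Q → ℂ) {z : V} (hz : z ∉ Q) :
    extendZero Q f z = 0 := by
  simp [extendZero, hz]

/-- `B` moves mass by distance at most `r`, so nothing leaves `Q` when the `r`-balls around the
support of `f` lie in `Q`. -/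
theorem funOp_extendZero (B : PatternAlgebra G) {r : ℕ}
    (hB : ∀ x y, r < G.dist x y → B x y = 0) {Q : Finset V} {f : Q → ℂ}
    (hf : ∀ z, f z ≠ 0 → ball G (z : V) r ⊆ Q) :
    funOp B (extendZero Q f) = extendZero Q ((compression B Q).mulVec f) := by
  classical
  ext y
  rw [funOp_apply]
  by_cases hy : y ∈ Q
  · rw [extendZero_mem _ (⟨y, hy⟩ : Q), finsum_eq_sum_of_support_subset (s := Q)]
    · rw [← Finset.sum_coe_sort]
      refine Finset.sum_congr rfl fun z _ => ?_
      rw [extendZero_mem]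
      rfl
    · intro z hz
      by_contra h
      exact right_ne_zero_of_mul hz (extendZero_notMem f h)
  · rw [extendZero_notMem _ hy]
    refine finsum_eq_zero_of_forall_eq_zero fun z => ?_
    by_contra h
    have hz : z ∈ Q := by
      by_contra hz
      exact right_ne_zero_of_mul h (extendZero_notMem f hz)
    have h1 := right_ne_zero_of_mul h
    rw [extendZero_mem f ⟨z, hz⟩] at h1
    refine hy (hf ⟨z, hz⟩ h1 ?_)
    by_contra h2
    refine left_ne_zero_of_mul h (hB y z ?_)
    rw [SimpleGraph.dist_comm]
    simpa [ball] using h2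

/-- Each application of `B` enlarges the support by at most `r`. The second conclusion records this
so that the induction can use `funOp_extendZero`. -/
theorem pow_compression [DecidableEq V] (B : PatternAlgebra G) {r : ℕ}
    (hB : ∀ x y, r < G.dist x y → B x y = 0) {Q : Finset V} (x : Q) (m : ℕ)
    (hx : ball G (x : V) (m * r) ⊆ Q) :
    (funOp B ^ m) (Pi.single (x : V) 1)
        = extendZero Q ((compression B Q ^ m).mulVec (Pi.single x 1)) ∧
      ∀ z, (compression B Q ^ m).mulVec (Pi.single x 1) z ≠ 0 → G.dist (x : V) z ≤ m * r := by
  have hG : G.Connected := IsAQGraph.connected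
  induction m with
  | zero =>
    simp only [pow_zero, Module.End.one_apply, Matrix.one_mulVec]
    refine ⟨?_, fun z hz => ?_⟩
    · ext z
      by_cases hz : z ∈ Q
      · rw [extendZero_mem _ (⟨z, hz⟩ : Q)]
        simp [Pi.single_apply, Subtype.ext_iff]
      · rw [extendZero_notMem _ hz, Pi.single_eq_of_ne]
        rintro rfl
        exact hz x.2
    · have : z = x := by
        by_contra h
        exact hz (Pi.single_eq_of_ne h _)
      simp [this]
  | succ m ih =>
    have hmr : (m + 1) * r = m * r + r := by ring
    obtain ⟨h1, h2⟩ := ih (fun y hy => hx (by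
      have hy' : G.dist (x : V) y ≤ m * r := hy
      show G.dist (x : V) y ≤ (m + 1) * r
      omega))
    rw [pow_succ', pow_succ', Module.End.mul_apply, ← Matrix.mulVec_mulVec, h1]
    refine ⟨funOp_extendZero B hB fun z hz y hy => hx ?_, fun z hz => ?_⟩
    · have h3 := h2 z hz
      have h4 : G.dist (z : V) y ≤ r := hy
      have := hG.dist_triangle (u := (x : V)) (v := z) (w := y)
      show G.dist (x : V) y ≤ (m + 1) * r
      omega
    · obtain ⟨w, -, hw⟩ := Finset.exists_ne_zero_of_sum_ne_zero hz
      have h3 := h2 w (right_ne_zero_of_mul hw)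
      have h4 : G.dist (z : V) w ≤ r := by
        by_contra h
        exact left_ne_zero_of_mul hw (hB _ _ (by omega))
      have := hG.dist_triangle (u := (x : V)) (v := w) (w := z)
      rw [SimpleGraph.dist_comm] at h4
      omega

theorem aeval_compression [DecidableEq V] (B : PatternAlgebra G) {r : ℕ}
    (hB : ∀ x y, r < G.dist x y → B x y = 0) (p : ℂ[X]) {Q : Finset V} (x : Q)
    (hx : ball G (x : V) (p.natDegree * r) ⊆ Q) :
    aeval (funOp B) p (Pi.single (x : V) 1)
      = extendZero Q ((aeval (compression B Q) p).mulVec (Pi.single x 1)) := by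
  rw [aeval_eq_sum_range, aeval_eq_sum_range, Matrix.sum_mulVec, map_sum, LinearMap.sum_apply]
  refine Finset.sum_congr rfl fun i hi => ?_
  rw [LinearMap.smul_apply, Matrix.smul_mulVec, map_smul, (pow_compression B hB x i _).1]
  refine fun y hy => hx ?_
  have hi' : i ≤ p.natDegree := by simpa [Nat.lt_succ_iff] using hi
  exact le_trans (show G.dist (x : V) y ≤ i * r from hy) (Nat.mul_le_mul_right r hi')

/-- The diagonal entry is the squared norm of a column of `p(B)`, and deep inside `Q` that column is
the one computed from the compression. -/
theorem diag_polyEval [DecidableEq V] (B : PatternAlgebra G) {r : ℕ}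
    (hB : ∀ x y, r < G.dist x y → B x y = 0) (p : ℂ[X]) {Q : Finset V} (x : Q)
    (hx : ball G (x : V) (p.natDegree * r) ⊆ Q) :
    ((star (polyEval B p) * polyEval B p) (x : V) x).re
      = ∑ z : Q, ‖aeval (compression B Q) p z x‖ ^ 2 := by
  have h1 := polyEval_column B p x
  have h2 := aeval_compression B hB p x hx
  have h3 : (fun z => polyEval B p z x) = extendZero Q fun z => aeval (compression B Q) p z x := by
    rw [h1, h2, Matrix.mulVec_single_one]
    rfl
  rw [star_mul_self_diag, Complex.ofReal_re,
    Finset.sum_subset (s₂ := Q) (f := fun z => ‖polyEval B p z x‖ ^ 2), ← Finset.sum_coe_sort]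
  · refine Finset.sum_congr rfl fun z _ => ?_
    rw [congrFun h3 z, extendZero_mem]
  · intro z hz
    by_contra h
    have : polyEval B p z x ≠ 0 := by simpa using hz
    exact this ((congrFun h3 z).trans (extendZero_notMem _ h))
  · intro z _ hz
    have : polyEval B p z x = 0 := by simpa using hz
    simp [this]

end compression

/-! ### Vertices near the boundary of a finite set -/

section boundary

variable {V : Type*} (G : SimpleGraph V) [IsAQGraph G]

/-- Going back from `y` towards `x` along a geodesic, the first vertex met in `Q` has a neighbour
outside. -/
theorem exists_innerBoundary_dist_le {Q : Finset V} {x y : V} (hx : x ∈ Q) (hy : y ∉ Q) {s : ℕ}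
    (hxy : G.dist x y ≤ s) : ∃ p ∈ innerBoundary G Q, G.dist p x ≤ s := by
  have hG : G.Connected := IsAQGraph.connected
  induction s generalizing y with
  | zero =>
    have : x = y := hG.dist_eq_zero_iff.1 (by omega)
    exact (hy (this ▸ hx)).elim
  | succ s ih =>
    by_cases h : G.dist x y ≤ s
    · obtain ⟨p, hp, hps⟩ := ih hy h
      exact ⟨p, hp, by omega⟩
    · obtain ⟨z, hz, hzy⟩ := exists_pred hG (x := x) (y := y) (s := s) (by omega)
      by_cases hzQ : z ∈ Q
      · exact ⟨z, ⟨hzQ, y, hy, hzy⟩, by rw [SimpleGraph.dist_comm]; omega⟩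
      · obtain ⟨p, hp, hps⟩ := ih hzQ hz.le
        exact ⟨p, hp, by omega⟩

-- The vertices counted lie within `R` of the inner boundary, and balls of radius `R` have uniformly
-- bounded size.
open Classical in
theorem exists_card_le_innerBoundary (R : ℕ) : ∃ N : ℕ, ∀ Q : Finset V,
    (Q.filter fun x => ¬ ball G x R ⊆ Q).card ≤ N * (innerBoundary G Q).ncard := by
  obtain ⟨N, hN⟩ := ball_bound G R
  refine ⟨N, fun Q => ?_⟩
  have hfin : (innerBoundary G Q).Finite := Q.finite_toSet.subset fun p hp => hp.1
  rw [Set.ncard_eq_toFinset_card _ hfin, mul_comm]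
  refine (Finset.card_le_card (t := hfin.toFinset.biUnion
    fun p => (ball_finite G p R).toFinset) fun x hx => ?_).trans
    (Finset.card_biUnion_le_card_mul _ _ _ fun p _ => ?_)
  · obtain ⟨hxQ, h⟩ := Finset.mem_filter.1 hx
    obtain ⟨y, hy, hyQ⟩ := Set.not_subset.1 h
    obtain ⟨p, hp, hpx⟩ := exists_innerBoundary_dist_le G hxQ hyQ hy
    exact Finset.mem_biUnion.2 ⟨p, by simpa using hp, by simpa [ball] using hpx⟩
  · have := hN p
    rw [(ball_finite G p R).encard_eq_coe_toFinset_card] at this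
    exact_mod_cast this

end boundary

/-! ### Entries of pattern-invariant matrices, and a trace bound -/

section entries

variable {V : Type*} {G : SimpleGraph V} [IsAQGraph G]

/-- Every nonzero entry already occurs in the ball around a representative of one of the finitely
many patterns. -/
theorem finite_entries (A : PatternAlgebra G) :
    (Set.range fun p : V × V => A p.1 p.2).Finite := by
  obtain ⟨r, hr⟩ := A.2
  have := finite_patterns G r
  refine ((Set.finite_iUnion fun q : Quotient (patternSetoid G r) =>
    (ball_finite G q.out r).image fun y => A q.out y).union (Set.finite_singleton 0)).subset ?_
  rintro _ ⟨⟨x, y⟩, rfl⟩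
  by_cases h : y ∈ ball G x r
  · obtain ⟨φ, hφ⟩ : SamePattern G r x (Quotient.mk (patternSetoid G r) x).out :=
      samePattern_symm G (Quotient.mk_out (s := patternSetoid G r) x)
    refine Or.inl (Set.mem_iUnion.2 ⟨Quotient.mk _ x, _, (φ ⟨y, h⟩).2, ?_⟩)
    exact (hr.2 _ _ φ hφ ⟨y, h⟩).symm
  · exact Or.inr (hr.1 x y (by simpa [ball] using h))

theorem exists_common_denominator {S : Set ℂ} (hS : S.Finite) (hq : ∀ u ∈ S, ∃ q : ℚ, u = q) :
    ∃ D : ℕ, 0 < D ∧ ∀ u ∈ S, ∃ z : ℤ, (D : ℂ) * u = z := by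
  induction S, hS using Set.Finite.induction_on with
  | empty => exact ⟨1, one_pos, by simp⟩
  | @insert a S _ _ ih =>
    obtain ⟨D, hD, h⟩ := ih fun u hu => hq u (Set.mem_insert_of_mem _ hu)
    obtain ⟨q, hqa⟩ := hq a (Set.mem_insert _ _)
    refine ⟨q.den * D, Nat.mul_pos q.den_pos hD, fun u hu => ?_⟩
    rcases hu with rfl | hu
    · refine ⟨D * q.num, ?_⟩
      have := Rat.mul_den_eq_num q
      rw [hqa]
      have h2 : (q : ℂ) * (q.den : ℂ) = (q.num : ℂ) := by exact_mod_cast this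
      push_cast
      rw [← h2]
      ring
    · obtain ⟨z, hz⟩ := h u hu
      refine ⟨q.den * z, ?_⟩
      push_cast
      rw [← hz]
      ring

theorem exists_row_sum_bound (A : PatternAlgebra G) :
    ∃ K : ℝ, 0 ≤ K ∧ ∀ (Q : Finset V) (x : V), ∑ y ∈ Q, ‖A x y‖ ≤ K := by
  classical
  obtain ⟨M, hM, hAM⟩ := entries_bound G A.2
  obtain ⟨r, hr⟩ := A.2
  obtain ⟨N, hN⟩ := ball_bound G r
  refine ⟨N * M, by positivity, fun Q x => ?_⟩
  set b := (ball_finite G x r).toFinset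
  have hb : b.card ≤ N := by
    have := hN x
    rw [(ball_finite G x r).encard_eq_coe_toFinset_card] at this
    exact_mod_cast this
  calc ∑ y ∈ Q, ‖A x y‖ = ∑ y ∈ Q.filter (· ∈ b), ‖A x y‖ := by
        rw [Finset.sum_filter_of_ne]
        intro y _ hy
        by_contra h
        refine hy (norm_eq_zero.2 (hr.1 x y ?_))
        simpa [b, ball] using h
    _ ≤ (Q.filter (· ∈ b)).card • M := Finset.sum_le_card_nsmul _ _ _ fun y _ => hAM x y
    _ ≤ N * M := by
        rw [nsmul_eq_mul]
        gcongr
        refine le_trans (Finset.card_le_card fun y hy => ?_) hb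
        exact (Finset.mem_filter.1 hy).2

/-- After division by `Q.card` the boundary term tends to 0 along a Følner sequence. -/
theorem re_trace_le_of_boundary (A : PatternAlgebra G) (β C : ℝ)
    (h : ∀ Q : Finset V, ∑ x ∈ Q, (A x x).re ≤ β * Q.card + C * (innerBoundary G Q).ncard) :
    (trace A).re ≤ β := by
  obtain ⟨Q, hQ⟩ := IsAQGraph.amenable (G := G)
  have hlim := (hQ.2.const_mul C).const_add β
  rw [mul_zero, add_zero] at hlim
  refine le_of_tendsto_of_tendsto' ((Complex.continuous_re.tendsto _).comp (trace_tendsto A hQ))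
    hlim fun n => ?_
  have hpos : (0 : ℝ) < (Q n).card := by exact_mod_cast (hQ.1 n).card_pos
  simp only [Function.comp, Complex.div_natCast_re, Complex.re_sum]
  rw [div_le_iff₀ hpos]
  refine (h (Q n)).trans (le_of_eq ?_)
  field_simp

end entries

/-! ### Comparing the trace with compressions -/

section conclusion

variable {V : Type*} {G : SimpleGraph V} [IsAQGraph G]

/-- Up to a boundary term, the trace of `p(B)* p(B)` over a finite set of vertices is the
Hilbert-Schmidt norm of `p` of the compression. -/
theorem exists_trace_polyEval_bound [DecidableEq V] (B : PatternAlgebra G) (p : ℂ[X]) :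
    ∃ C : ℝ, ∀ Q : Finset V,
      ∑ x ∈ Q, ((star (polyEval B p) * polyEval B p) x x).re
        ≤ ∑ x : Q, ∑ z : Q, ‖aeval (compression B Q) p z x‖ ^ 2
          + C * (innerBoundary G Q).ncard := by
  classical
  obtain ⟨r, hr⟩ := B.2
  obtain ⟨N, hN⟩ := exists_card_le_innerBoundary G (p.natDegree * r)
  obtain ⟨M, hM, hPM⟩ := entries_bound G (star (polyEval B p) * polyEval B p).2
  refine ⟨M * N, fun Q => ?_⟩
  -- Near the boundary the compression says nothing, so the entry is bounded crudely by `M`; the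
  -- number of such vertices is at most `N` times the boundary.
  have hx : ∀ x : Q, ((star (polyEval B p) * polyEval B p) (x : V) x).re ≤
      ∑ z : Q, ‖aeval (compression B Q) p z x‖ ^ 2
        + if ¬ ball G (x : V) (p.natDegree * r) ⊆ Q then M else 0 := by
    intro x
    by_cases h : ball G (x : V) (p.natDegree * r) ⊆ Q
    · rw [diag_polyEval B hr.1 p x h, if_neg (not_not.2 h), add_zero]
    · rw [if_pos h]
      have h1 : ((star (polyEval B p) * polyEval B p) (x : V) x).re ≤ M :=
        (Complex.re_le_norm _).trans (hPM x x)
      have h2 : 0 ≤ ∑ z : Q, ‖aeval (compression B Q) p z x‖ ^ 2 := by positivity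
      linarith
  rw [← Finset.sum_coe_sort]
  refine (Finset.sum_le_sum fun x _ => hx x).trans ?_
  rw [Finset.sum_add_distrib]
  gcongr
  rw [Finset.sum_coe_sort Q fun x => if ¬ ball G x (p.natDegree * r) ⊆ Q then M else 0,
    ← Finset.sum_filter, Finset.sum_const, nsmul_eq_mul, mul_comm, mul_assoc]
  gcongr
  exact_mod_cast hN Q

theorem compression_isHermitian {B : PatternAlgebra G} (hB : star B = B) (Q : Finset V) :
    (compression B Q).IsHermitian := by
  ext x y
  have h := congrArg (fun A : PatternAlgebra G => A (x : V) y) hB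
  exact h

end conclusion

end AQ

/-! ### The theorem -/

open Polynomial in
theorem corollary1 {V : Type*} (G : SimpleGraph V) [AQ.IsAQGraph G] (B : AQ.PatternAlgebra G)
    (hpos : (AQ.l2Op B).IsPositive) (hrat : ∀ x y : V, ∃ q : ℚ, B x y = (q : ℂ))
    (c : ℝ) (hc : ¬ ContinuousAt (AQ.ids B) c) : IsAlgebraic ℚ c := by
  classical
  by_contra htr
  have hB := AQ.star_eq_self_of_isPositive hpos
  obtain ⟨δ, hδ, hjump⟩ := AQ.exists_le_norm_sq_of_not_continuousAt (c := c)
    (AQ.gnsRep_isSelfAdjoint hB) ((1 : AQ.PatternAlgebra G) : AQ.GNS G)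
    (by simpa only [funext (AQ.ids_eq B)] using hc)
  obtain ⟨D, hD, hint⟩ := AQ.exists_common_denominator (AQ.finite_entries B) (by
    rintro _ ⟨⟨x, y⟩, rfl⟩; exact hrat x y)
  obtain ⟨K, hK, hrow⟩ := AQ.exists_row_sum_bound B
  -- Makes the eigenvalues near `c` at most a proportion `δ / 4`; the power `k` below makes the tail
  -- of the bump at most another `δ / 4`. Both are fixed before any finite set `Q` is considered.
  obtain ⟨j, hj⟩ := exists_nat_gt (4 / δ)
  have hj0 : (0 : ℝ) < j := lt_trans (by positivity) hj
  obtain ⟨ε, hε, hspread⟩ := AQ.exists_eigenvalue_spread htr hK hD j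
  -- Bounds `(λ - c)²` for the eigenvalues of all compressions; the summand 1 makes it positive.
  set M := (K + |c|) ^ 2 + 1 with hM
  have hMpos : 0 < M := by positivity
  have hρ : max (1 - ε ^ 2 / M) 0 < 1 :=
    max_lt (by linarith [show 0 < ε ^ 2 / M by positivity]) one_pos
  obtain ⟨k, hk⟩ := exists_pow_lt_of_lt_one (show 0 < δ / 4 by positivity) hρ
  have h1 := hjump (AQ.bump c M k) (by simp [AQ.bump])
  rw [AQ.norm_sq_aeval_gnsRep] at h1
  obtain ⟨C, hC⟩ := AQ.exists_trace_polyEval_bound B (AQ.bump c M k)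
  have h2 : (AQ.trace (star (AQ.polyEval B (AQ.bump c M k))
      * AQ.polyEval B (AQ.bump c M k))).re ≤ δ / 2 := by
    refine AQ.re_trace_le_of_boundary _ _ C fun Q => (hC Q).trans ?_
    gcongr
    have hA := AQ.compression_isHermitian hB Q
    have hrowQ : ∀ x, ∑ y, ‖AQ.compression B Q x y‖ ≤ K := fun x => by
      have := hrow Q x
      rwa [← Finset.sum_coe_sort] at this
    have h3 := hspread hA (fun x y => hint _ ⟨(x, y), rfl⟩) hrowQ
    rw [Fintype.card_coe] at h3
    have h4 := AQ.sum_norm_sq_bump_le hA (c := c) (M := M) k hMpos (fun i => by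
      have h5 := AQ.abs_eigenvalues_le hA hrowQ i
      have h6 := abs_sub (hA.eigenvalues i) c
      have h7 : (hA.eigenvalues i - c) ^ 2 ≤ (K + |c|) ^ 2 := by
        rw [← sq_abs]
        gcongr
        linarith
      linarith) hε
    rw [Fintype.card_coe] at h4
    refine h4.trans ?_
    set m := (Finset.univ.filter fun i => |hA.eigenvalues i - c| < ε).card
    have h8 : (j : ℝ) * m ≤ Q.card := by exact_mod_cast h3
    have h9 : (m : ℝ) ≤ δ / 4 * Q.card := by
      rw [div_lt_iff₀ hδ] at hj
      have hm : (0 : ℝ) ≤ m := by positivity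
      nlinarith
    have h10 : (Q.card : ℝ) * max (1 - ε ^ 2 / M) 0 ^ k ≤ Q.card * (δ / 4) := by gcongr
    linarith
  linarith
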